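/- Let $m$ be an odd prime, $F=\mathbb{F}_q$ a finite field of odd characteristic containing a primitive $m$-th root of unity $\zeta$, and let $K=\mathbb{F}_{q^m}$. *Algebras.* For a cyclic Galois extension $L/F$ of degree $m$, a generator $\sigma$ of $\mathrm{Gal}(L/F)$ and $a\in L$, let $(L/F,\sigma,a)$ be the $F$-algebra $L[t;\sigma]/L[t;\sigma](t^m-a)$: its elements are the twisted polynomials $\sum_{i<m}x_it^i$ with $x_i\in L$, where $tc=\sigma(c)t$ for $c\in L$, and the product of $g$ and $h$ is the remainder of $gh$ under right division by $t^m-a$. By a (proper) nonassociative cyclic algebra of degree $m$ over $F$ we mean such an algebra with $a\in L\smallsetminus F$. Two $F$-algebras $A,A'$ are isotopic if there are $F$-linear bijections $f,g:A\to A'$ and $h:A'\to A$ with $xy=h(f(x)g(y))$ for all $x,y\in A$. *The set $\mathcal S(K)$.* Fix a generator $\sigma_0$ of $\mathrm{Gal}(K/F)$ and $\beta\in K$ with $\beta^m=b\in F$, where $b$ is not an $m$-th power in $F$, and $\sigma_0(\beta)=\zeta\beta$. For every nonempty $I=\{i_0<i_1<\dots<i_k\}\subseteq\{0,\dots,m-1\}$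 with $I\neq\{0\}$, choose a set $T_I$ of representatives of the cosets in $(F^\times)^k$ of the subgroup $$\Delta_I=\{(\zeta^{s(i_1-i_0)},\dots,\zeta^{s(i_k-i_0)}) : 1\le s\le m\}$$ (for $k=0$, $T_I$ consists of the empty tuple), and put $$K(I;1)=\Big\{\beta^{i_0}+\sum_{j=1}^k a_{i_j}\beta^{i_j} : (a_{i_1},\dots,a_{i_k})\in T_I\Big\},\qquad \mathcal S(K)=\bigcup_I K(I;1).$$ *Theorem.* 1. For every generator $\sigma$ of $\mathrm{Gal}(K/F)$ and every $a\in\mathcal S(K)$ we have $a\notin F$, and $(K/F,\sigma,a)$ is not associative. 2. Every Galois extension $L/F$ of degree $m$ is isomorphic to $K/F$, and every nonassociative cyclic algebra $(L/F,\tau,c)$ with $\tau$ a generator of $\mathrm{Gal}(L/F)$ and $c\in L\smallsetminus F$ is isomorphic over $F$ to $(K/F,\sigma,a)$ for some generator $\sigma$ of $\mathrm{Gal}(K/F)$ and some $a\in\mathcal S(K)$. 3. If $(K/F,\sigma,a)\cong(K/F,\sigma',a')$ over $F$ with generators $\sigma,\sigma'$ and $a,a'\in\mathcal S(K)$, then $\sigma=\sigma'$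 and $a=a'$. So the algebras $(K/F,\sigma,a)$, with $\sigma$ a generator and $a\in\mathcal S(K)$, represent each isomorphism class of nonassociative cyclic algebras of degree $m$ over $F$ exactly once. 4. For each fixed generator $\sigma$ of $\mathrm{Gal}(K/F)$, the same set also represents the isotopy classes: for every $c\in K\smallsetminus F$ there is exactly one $a\in\mathcal S(K)$ such that $(K/F,\sigma,c)$ and $(K/F,\sigma,a)$ are isotopic. -/

import Mathlib

noncomputable section

/-! ### Nonassociative algebras: isomorphism and isotopy -/

/-- Isomorphism of (nonassociative) `F`-algebras: an `F`-linear bijection respecting products. -/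
def AlgIsomorphic (F A B : Type*) [Field F]
    [NonUnitalNonAssocRing A] [Module F A] [NonUnitalNonAssocRing B] [Module F B] : Prop :=
  ∃ φ : A ≃ₗ[F] B, ∀ x y : A, φ (x * y) = φ x * φ y

/-- Isotopy of (nonassociative) `F`-algebras: `x y = h (f(x) g(y))` for `F`-linear bijections
`f, g, h`. -/
def AlgIsotopic (F A B : Type*) [Field F]
    [NonUnitalNonAssocRing A] [Module F A] [NonUnitalNonAssocRing B] [Module F B] : Prop :=
  ∃ (f g : A ≃ₗ[F] B) (h : B ≃ₗ[F] A), ∀ x y : A, x * y = h (f x * g y)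

/-! ### The algebras `K[t;σ]/K[t;σ](t^m - a)` -/

/-- The underlying space of `K[t;σ]/K[t;σ](t^m - a)`: twisted polynomials
`x_0 + x_1 t + ⋯ + x_{m-1} t^{m-1}` of degree less than `m`, given by their coefficients.
When `K/F` is a cyclic Galois extension of degree `m`, with group generated by `σ`, this is
the algebra `(K/F, σ, a)`. -/
@[ext]
structure CyclicAlg {F K : Type*} [Field F] [Field K] [Algebra F K]
    (m : ℕ) (σ : K ≃ₐ[F] K) (a : K) where
  coeff : Fin m → K

namespace CyclicAlg

variable {F K : Type*} [Field F] [Field K] [Algebra F K] {m : ℕ} {σ : K ≃ₐ[F] K} {a : K}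

/-- An element is the same as its family of coefficients. -/
def equivFun : CyclicAlg m σ a ≃ (Fin m → K) where
  toFun x := x.coeff
  invFun f := ⟨f⟩
  left_inv _ := rfl
  right_inv _ := rfl

instance : AddCommGroup (CyclicAlg m σ a) := equivFun.addCommGroup

instance : Module F (CyclicAlg m σ a) := equivFun.module F

theorem coeff_zero : (0 : CyclicAlg m σ a).coeff = 0 := rfl

theorem coeff_add (x y : CyclicAlg m σ a) : (x + y).coeff = x.coeff + y.coeff := rfl

theorem coeff_smul (c : F) (x : CyclicAlg m σ a) : (c • x).coeff = c • x.coeff := rfl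

/-- The coefficient of `t^k` in the product, taken in `K[t;σ]` (where `t c = σ(c) t`), of the
twisted polynomials `∑ x_i t^i` and `∑ y_j t^j`. -/
def twistedCoeff (σ : K ≃ₐ[F] K) (x y : Fin m → K) (k : ℕ) : K :=
  ∑ i : Fin m, ∑ j : Fin m, if (i : ℕ) + (j : ℕ) = k then x i * (σ ^ (i : ℕ)) (y j) else 0

/-- The product `x ∘ y` is the remainder of the twisted product `x y` under right division by
`t^m - a`. Since `c t^(k+m) = c t^k (t^m - a) + c σ^k(a) t^k`, its coefficient at `t^k` is
`c_k + c_{k+m} σ^k(a)`, where the `c_k` are the coefficients of the twisted product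
(see `mod_right_eq`). -/
instance : Mul (CyclicAlg m σ a) where
  mul x y := ⟨fun k : Fin m => twistedCoeff σ x.coeff y.coeff k +
    twistedCoeff σ x.coeff y.coeff (k + m) * (σ ^ (k : ℕ)) a⟩

theorem coeff_mul (x y : CyclicAlg m σ a) (k : Fin m) :
    (x * y).coeff k = twistedCoeff σ x.coeff y.coeff k +
      twistedCoeff σ x.coeff y.coeff (k + m) * (σ ^ (k : ℕ)) a := rfl

theorem twistedCoeff_add_left (x x' y : Fin m → K) (k : ℕ) :
    twistedCoeff σ (x + x') y k = twistedCoeff σ x y k + twistedCoeff σ x' y k := by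
  simp only [twistedCoeff, ← Finset.sum_add_distrib]
  refine Finset.sum_congr rfl fun i _ => Finset.sum_congr rfl fun j _ => ?_
  split_ifs <;> simp [add_mul]

theorem twistedCoeff_add_right (x y y' : Fin m → K) (k : ℕ) :
    twistedCoeff σ x (y + y') k = twistedCoeff σ x y k + twistedCoeff σ x y' k := by
  simp only [twistedCoeff, ← Finset.sum_add_distrib]
  refine Finset.sum_congr rfl fun i _ => Finset.sum_congr rfl fun j _ => ?_
  split_ifs <;> simp [mul_add]

theorem twistedCoeff_zero_left (y : Fin m → K) (k : ℕ) : twistedCoeff σ 0 y k = 0 := by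
  simp [twistedCoeff]

theorem twistedCoeff_zero_right (x : Fin m → K) (k : ℕ) : twistedCoeff σ x 0 k = 0 := by
  simp [twistedCoeff]

instance : NonUnitalNonAssocRing (CyclicAlg m σ a) where
  left_distrib x y z := by
    ext k
    simp only [coeff_mul, coeff_add, Pi.add_apply, twistedCoeff_add_right]
    ring
  right_distrib x y z := by
    ext k
    simp only [coeff_mul, coeff_add, Pi.add_apply, twistedCoeff_add_left]
    ring
  zero_mul x := by
    ext k
    simp only [coeff_mul, coeff_zero, Pi.zero_apply, twistedCoeff_zero_left, zero_mul, add_zero]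
  mul_zero x := by
    ext k
    simp only [coeff_mul, coeff_zero, Pi.zero_apply, twistedCoeff_zero_right, zero_mul, add_zero]

open SkewPolynomial in
/-- In the skew polynomial ring `K[t;σ]` (for the action in which `t` acts as `σ`), the product
`x ∘ y` is the remainder of `x y` under right division by `t^m - a`. -/
theorem mod_right_eq [MulSemiringAction (Multiplicative ℕ) K]
    (hφ : ∀ c : K, Multiplicative.ofAdd 1 • c = σ c) (x y : CyclicAlg m σ a) :
    (∑ i : Fin m, monomial (i : ℕ) (x.coeff i)) * (∑ j : Fin m, monomial (j : ℕ) (y.coeff j)) =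
      (∑ k : Fin m, monomial (k : ℕ) (twistedCoeff σ x.coeff y.coeff (k + m))) * (X ^ m - C a) +
        ∑ k : Fin m, monomial (k : ℕ) ((x * y).coeff k) := by
  have hit : ∀ (n : ℕ) (c : K), (φ : K →+* K)^[n] c = (σ ^ n) c := by
    intro n
    induction n with
    | zero => intro c; rfl
    | succ n ih =>
      intro c
      rw [Function.iterate_succ_apply, ih, pow_succ, AlgEquiv.mul_apply]
      exact congrArg _ (hφ c)
  have hL : (∑ i : Fin m, monomial (i : ℕ) (x.coeff i)) * (∑ j : Fin m, monomial (j : ℕ) (y.coeff j)) =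
      ∑ k ∈ Finset.range (m + m), monomial k (twistedCoeff σ x.coeff y.coeff k) := by
    simp only [twistedCoeff, map_sum]
    rw [Finset.sum_comm, Finset.sum_mul]
    refine Finset.sum_congr rfl fun i _ => ?_
    rw [Finset.sum_comm, Finset.mul_sum]
    refine Finset.sum_congr rfl fun j _ => ?_
    rw [monomial_mul_monomial, hit,
      Finset.sum_eq_single_of_mem ((i : ℕ) + (j : ℕ)) (Finset.mem_range.2 (by omega))]
    · rw [if_pos rfl]
    · intro k _ hk
      rw [if_neg (Ne.symm hk), map_zero]
  rw [hL, Finset.sum_range_add, mul_sub, Finset.sum_mul, Finset.sum_mul]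
  simp only [monomial_mul_X_pow, monomial_mul_C, hit, coeff_mul, map_add, Finset.sum_add_distrib]
  rw [Finset.sum_range fun k => monomial k (twistedCoeff σ x.coeff y.coeff k),
    Finset.sum_range fun k => monomial (m + k) (twistedCoeff σ x.coeff y.coeff (m + k))]
  simp only [add_comm m]
  abel

end CyclicAlg

/-! ### The parametrizing set -/

/-- The index sets: nonempty subsets of `{0, …, m-1}`, excluding `{0}`. -/
def indexSets (m : ℕ) : Set (Finset ℕ) :=
  {I | I ⊆ Finset.range m ∧ I ≠ ∅ ∧ I ≠ {0}}

/-- The least element `i_0` of a (nonempty) index set. -/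
def leadIdx (I : Finset ℕ) : ℕ := sInf (I : Set ℕ)

/-- Tuples `(a_{i_1}, …, a_{i_k})` of nonzero scalars indexed by `I \ {i_0}`. -/
abbrev TailTuple (F : Type*) [Field F] (I : Finset ℕ) : Type _ :=
  {i // i ∈ I.erase (leadIdx I)} → Fˣ

/-- `Δ_I`, the tuples `(ζ^(s(i_1 - i_0)), …, ζ^(s(i_k - i_0)))` with `1 ≤ s ≤ m`. -/
def deltaSet {F : Type*} [Field F] (m : ℕ) (ζ : F) (I : Finset ℕ) : Set (TailTuple F I) :=
  {v | ∃ s ∈ Finset.Icc 1 m, ∀ i : {i // i ∈ I.erase (leadIdx I)},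
    (v i : F) = ζ ^ (s * ((i : ℕ) - leadIdx I))}

/-- `T` is a choice of representatives for the cosets of `Δ_I`. When `I` is a singleton there is
only the empty tuple, and `T` consists of it. -/
def IsCosetReps {F : Type*} [Field F] (m : ℕ) (ζ : F) (I : Finset ℕ)
    (T : Set (TailTuple F I)) : Prop :=
  ∀ v : TailTuple F I, ∃! t : TailTuple F I, t ∈ T ∧ ∃ d ∈ deltaSet m ζ I, v = d * t

/-- `K(I; c)`: the elements `c β^(i_0) + ∑ a_i β^i`, the sum over `i ∈ I \ {i_0}`, with
`(a_i) ∈ T`. When `I = {i_0}` and `T` consists of the empty tuple this is `{c β^(i_0)}`. -/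
def repSet {F K : Type*} [Field F] [Field K] [Algebra F K] (β : K) (I : Finset ℕ)
    (T : Set (TailTuple F I)) (c : F) : Set K :=
  {x | ∃ t ∈ T, x = algebraMap F K c * β ^ leadIdx I +
    ∑ i : {i // i ∈ I.erase (leadIdx I)}, algebraMap F K (t i) * β ^ (i : ℕ)}

/-- The set `S(K)`, the union of the `K(I; 1)` over all index sets `I`. -/
def paramSet {F K : Type*} [Field F] [Field K] [Algebra F K] (m : ℕ) (β : K)
    (T : (I : Finset ℕ) → Set (TailTuple F I)) : Set K :=
  {x | ∃ I ∈ indexSets m, x ∈ repSet β I (T I) 1}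

/-- `σ` generates the Galois group of `K/F`. -/
def IsGalGenerator {F K : Type*} [Field F] [Field K] [Algebra F K] (σ : K ≃ₐ[F] K) : Prop :=
  ∀ τ : K ≃ₐ[F] K, τ ∈ Subgroup.zpowers σ

end

/-!
Everything is computed with the monomials `x t^i`. Reading exponents modulo `m`,
`(x t^i)(y t^j) = x σ^i(y) w(i, j) t^(i+j)`, where `w(i, j)` is `1` if `i + j < m` and `σ^(i+j)(a)`
otherwise. By the cocycle defect of `w` (`wrap_cocycle`), nonzero monomials of degrees `p`, `q`, `r`
associate exactly when `p + q < m` or `σ^r(a) = a`. For `a ∉ F` and `m` prime the latter means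
`r = 0`; so the algebra is not associative, and its left, middle and right nuclei are all `K`.

Let `H(xy) = f(x) g(y)` be an isotopism from `(K/F, σ, a)` to `(K/F, σ', a')`. It transports nuclei,
so `f`, `g` and `H` are semilinear for the actions of `K` on both sides, for suitable automorphisms
of `K/F`. The lines `K t^i` are pairwise nonisomorphic as bimodules, hence `f` and `g` permute them
(`exists_map_mono`).

If `σ = σ'`, then `f(t^i) = u_i t^(i+r)` and `g(t^j) = v_j t^(j+s)`. Comparing `H(t^i t^j)` with
`f(t^i) g(t^j)`, applying `σ^(-i-j)` and multiplying over all `j` yields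
`W A^i = N(u_i) V B^((i+r) mod m)`, where `A` and `B` are conjugates of `a` and `a'`, and `W`, `V` do
not depend on `i` (`exists_const_mul_pow_eq`). Two consecutive values of `i` without a wrap-around
on either side, which exist as `m ≥ 3`, show that `A / B` is a norm. Hence isotopy forces
`ρ(a) = n a'` with `ρ` in the Galois group and `n` in `F`, nonzero
(`exists_algEquiv_apply_eq_of_algIsotopic`).

If `f = g = H` is an isomorphism, the degrees are permuted by a map `j` with `σ'^(j(i)) = σ^i`. The
degree `q` with `j(q) = m - 1` must itself be `m - 1`, since otherwise `t, t^q, t` associate and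
their images do not; therefore `σ = σ'` (`eq_of_algIsomorphic`).

Conversely, when `ρ(a) = N(p) a'`, sending `t` to `p t` defines an isomorphism, and over a finite
field every element of `F` is a norm. It remains to see that the parametrizing set represents
`K \ F` modulo conjugation and scaling by nonzero elements of `F`. This is a computation in the basis
`1, β, …, β^(m-1)`, on which `σ₀` acts diagonally with eigenvalues `ζ^i`: scaling normalizes the lowest
nonzero coefficient, and conjugation then acts on the others through `Δ_I`.
-/

/-! ### Products of monomials -/

namespace CyclicAlg

section Monomials

variable {F K : Type*} [Field F] [Field K] [Algebra F K] {m : ℕ} {σ : K ≃ₐ[F] K} {a : K}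

/-- The monomial `x t^i`. -/
def mono (i : Fin m) (x : K) : CyclicAlg m σ a := ⟨Pi.single i x⟩

/-- The factor by which `t^i ∘ t^j` differs from `t^(i + j mod m)`: it is `1` if no reduction
occurs, and otherwise it is `σ^(i+j-m)(a)`, written as `σ^(i+j)(a)` because only automorphisms
with `σ^m = 1` are used. -/
def wrap (σ : K ≃ₐ[F] K) (a : K) (i j : Fin m) : K :=
  if (i : ℕ) + j < m then 1 else (σ ^ ((i : ℕ) + j)) a

/-- Multiplication by a scalar of `K` on the left, as an `F`-algebra homomorphism. -/
def lmul : K →ₐ[F] Module.End F (CyclicAlg m σ a) where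
  toFun k :=
    { toFun := fun x => ⟨fun i => k * x.coeff i⟩
      map_add' := fun x y => by ext i; simp [coeff_add, mul_add]
      map_smul' := fun c x => by ext i; simp [coeff_smul] }
  map_one' := by ext x i; simp
  map_mul' k l := by ext x i; simp [mul_assoc]
  map_zero' := by ext x i; simp [coeff_zero]
  map_add' k l := by ext x i; simp [coeff_add, add_mul]
  commutes' c := by ext x i; simp [coeff_smul, Algebra.smul_def]

/-- Multiplication by a scalar of `K` on the right, as an `F`-algebra homomorphism. -/
def rmul : K →ₐ[F] Module.End F (CyclicAlg m σ a) where
  toFun k :=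
    { toFun := fun x => ⟨fun i => x.coeff i * (σ ^ (i : ℕ)) k⟩
      map_add' := fun x y => by ext i; simp [coeff_add, add_mul]
      map_smul' := fun c x => by ext i; simp [coeff_smul] }
  map_one' := by ext x i; simp
  map_mul' k l := by ext x i; simp; ring
  map_zero' := by ext x i; simp [coeff_zero]
  map_add' k l := by ext x i; simp [coeff_add, mul_add]
  commutes' c := by ext x i; simp [coeff_smul, Algebra.smul_def, mul_comm]

theorem coeff_lmul (k : K) (x : CyclicAlg m σ a) (i : Fin m) :
    (lmul k x).coeff i = k * x.coeff i := rfl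

theorem coeff_rmul (k : K) (x : CyclicAlg m σ a) (i : Fin m) :
    (rmul k x).coeff i = x.coeff i * (σ ^ (i : ℕ)) k := rfl

theorem coeff_mono (i j : Fin m) (x : K) :
    (mono i x : CyclicAlg m σ a).coeff j = if j = i then x else 0 := by
  simp [mono, Pi.single_apply]

theorem coeff_mono_self (i : Fin m) (x : K) : (mono i x : CyclicAlg m σ a).coeff i = x := by
  simp [coeff_mono]

theorem mono_injective (i : Fin m) :
    Function.Injective (mono i : K → CyclicAlg m σ a) := fun x y h => by
  rw [← coeff_mono_self (σ := σ) (a := a) i x, h, coeff_mono_self]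

theorem mono_zero (i : Fin m) : (mono i 0 : CyclicAlg m σ a) = 0 := by
  ext j; simp [coeff_mono, coeff_zero]

theorem mono_ne_zero (i : Fin m) {x : K} (hx : x ≠ 0) : (mono i x : CyclicAlg m σ a) ≠ 0 := by
  rw [← mono_zero i]
  exact (mono_injective i).ne hx

theorem lmul_mono (i : Fin m) (k x : K) :
    lmul k (mono i x : CyclicAlg m σ a) = mono i (k * x) := by
  ext j; simp [coeff_lmul, coeff_mono]

theorem rmul_mono (i : Fin m) (k x : K) :
    rmul k (mono i x : CyclicAlg m σ a) = mono i (x * (σ ^ (i : ℕ)) k) := by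
  ext j
  rw [coeff_rmul, coeff_mono, coeff_mono]
  split_ifs with h
  · rw [h]
  · simp

theorem pow_mod_add (hσ : σ ^ m = 1) (n k : ℕ) : σ ^ (n % m + k) = σ ^ (n + k) := by
  rw [pow_add, pow_add, ← pow_eq_pow_mod n hσ]

/-- The product as a sum over pairs of degrees, with the degrees added in `ℤ/m`. -/
theorem coeff_mul_eq_sum (hσ : σ ^ m = 1) (x y : CyclicAlg m σ a) (k : Fin m) :
    (x * y).coeff k = ∑ i, ∑ j,
      if i + j = k then x.coeff i * (σ ^ (i : ℕ)) (y.coeff j) * wrap σ a i j else 0 := by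
  rw [coeff_mul]
  simp only [twistedCoeff, Finset.sum_mul, ← Finset.sum_add_distrib]
  refine Finset.sum_congr rfl fun i _ => Finset.sum_congr rfl fun j _ => ?_
  have hi := i.2
  have hj := j.2
  have hk := k.2
  simp only [Fin.ext_iff, Fin.val_add, wrap]
  by_cases hc : (i : ℕ) + j < m
  · rw [Nat.mod_eq_of_lt hc, if_pos hc, if_neg (show ¬ (i : ℕ) + j = k + m by omega)]
    simp
  · have h1 : ((i : ℕ) + j) % m = i + j - m := by
      rw [Nat.mod_eq_sub_mod (by omega), Nat.mod_eq_of_lt (by omega)]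
    rw [h1, if_neg hc, if_neg (show ¬ (i : ℕ) + j = k by omega), zero_add]
    by_cases h2 : (i : ℕ) + j - m = k
    · have h3 : (i : ℕ) + j = k + m := by omega
      rw [if_pos h2, if_pos h3, h3, pow_add, hσ, mul_one]
    · rw [if_neg h2, if_neg (by omega), zero_mul]

theorem pow_val_add (hσ : σ ^ m = 1) (i j : Fin m) :
    σ ^ ((i + j : Fin m) : ℕ) = σ ^ (i : ℕ) * σ ^ (j : ℕ) := by
  rw [Fin.val_add, ← pow_add]
  exact pow_mod_add hσ _ 0

theorem coeff_mul_mono (hσ : σ ^ m = 1) (x : CyclicAlg m σ a) (i j : Fin m) (y : K) :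
    (x * mono j y).coeff (i + j) = x.coeff i * (σ ^ (i : ℕ)) y * wrap σ a i j := by
  rw [coeff_mul_eq_sum hσ, Finset.sum_eq_single i, Finset.sum_eq_single j]
  · simp [coeff_mono]
  · intro j' _ hj'
    simp [hj']
  · simp
  · intro i' _ hi'
    refine Finset.sum_eq_zero fun j' _ => ?_
    rw [coeff_mono]
    split_ifs with h1 h2
    · subst h2
      exact absurd (add_right_cancel h1) hi'
    · simp
    · rfl
  · simp

theorem coeff_mono_mul (hσ : σ ^ m = 1) (y : CyclicAlg m σ a) (i j : Fin m) (x : K) :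
    (mono i x * y).coeff (i + j) = x * (σ ^ (i : ℕ)) (y.coeff j) * wrap σ a i j := by
  rw [coeff_mul_eq_sum hσ, Finset.sum_eq_single i, Finset.sum_eq_single j]
  · simp [coeff_mono]
  · intro j' _ hj'
    simp [hj']
  · simp
  · intro i' _ hi'
    refine Finset.sum_eq_zero fun j' _ => ?_
    simp [coeff_mono, hi']
  · simp

theorem lmul_mul (hσ : σ ^ m = 1) (k : K) (x y : CyclicAlg m σ a) :
    lmul k x * y = lmul k (x * y) := by
  ext l
  rw [coeff_lmul, coeff_mul_eq_sum hσ, coeff_mul_eq_sum hσ, Finset.mul_sum]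
  refine Finset.sum_congr rfl fun i _ => ?_
  rw [Finset.mul_sum]
  refine Finset.sum_congr rfl fun j _ => ?_
  rw [coeff_lmul, mul_ite, mul_zero, mul_assoc, mul_assoc, mul_assoc]

theorem rmul_mul (hσ : σ ^ m = 1) (k : K) (x y : CyclicAlg m σ a) :
    rmul k x * y = x * lmul k y := by
  ext l
  rw [coeff_mul_eq_sum hσ, coeff_mul_eq_sum hσ]
  refine Finset.sum_congr rfl fun i _ => Finset.sum_congr rfl fun j _ => ?_
  rw [coeff_lmul, coeff_rmul, map_mul, mul_assoc (x.coeff i)]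

theorem mul_rmul (hσ : σ ^ m = 1) (k : K) (x y : CyclicAlg m σ a) :
    x * rmul k y = rmul k (x * y) := by
  ext l
  rw [coeff_rmul, coeff_mul_eq_sum hσ, coeff_mul_eq_sum hσ, Finset.sum_mul]
  refine Finset.sum_congr rfl fun i _ => ?_
  rw [Finset.sum_mul]
  refine Finset.sum_congr rfl fun j _ => ?_
  rw [ite_mul, zero_mul]
  split_ifs with h
  · rw [coeff_rmul, map_mul, ← h, pow_val_add hσ, AlgEquiv.mul_apply]
    ring
  · rfl

/-- The cocycle identity for `wrap`, up to the defect that makes the algebra nonassociative. -/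
theorem wrap_cocycle (hσ : σ ^ m = 1) (p q r : Fin m) :
    wrap σ a p q * wrap σ a (p + q) r *
        (if (p : ℕ) + q < m then 1 else (σ ^ ((p : ℕ) + q + r)) a) =
      (σ ^ (p : ℕ)) (wrap σ a q r) * wrap σ a p (q + r) *
        (if (p : ℕ) + q < m then 1 else (σ ^ ((p : ℕ) + q)) a) := by
  have hp := p.2
  have hq := q.2
  have hr := r.2
  have e1 : σ ^ ((p + q : Fin m) + (r : ℕ)) = σ ^ ((p : ℕ) + q + r) := by
    rw [Fin.val_add, pow_mod_add hσ]
  have e2 : σ ^ ((p : ℕ) + (q + r : Fin m)) = σ ^ ((p : ℕ) + q + r) := by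
    rw [Fin.val_add, add_comm, pow_mod_add hσ]
    congr 1; ring
  have e3 : (σ ^ (p : ℕ)) ((σ ^ ((q : ℕ) + r)) a) = (σ ^ ((p : ℕ) + q + r)) a := by
    rw [← AlgEquiv.mul_apply, ← pow_add, add_assoc]
  have v : ∀ i j : Fin m, ((i + j : Fin m) : ℕ) = if (i : ℕ) + j < m then (i : ℕ) + j else i + j - m := by
    intro i j
    rw [Fin.val_add]
    split_ifs with h
    · exact Nat.mod_eq_of_lt h
    · rw [Nat.mod_eq_sub_mod (by omega), Nat.mod_eq_of_lt (by omega)]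
  have v1 := v p q
  have v2 := v q r
  simp only [wrap, e1, e2]
  by_cases h1 : (p : ℕ) + q < m <;> by_cases h2 : (q : ℕ) + r < m <;>
    by_cases h3 : ((p + q : Fin m) : ℕ) + r < m <;> by_cases h4 : (p : ℕ) + (q + r : Fin m) < m <;>
    simp only [h1, h2, h3, h4, if_true, if_false, map_one, one_mul, mul_one, e3] at v1 v2 ⊢ <;>
    first | (exfalso; omega) | ring

variable [NeZero m]

theorem mono_mul_mono (hσ : σ ^ m = 1) (i j : Fin m) (x y : K) :
    (mono i x * mono j y : CyclicAlg m σ a) =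
      mono (i + j) (x * (σ ^ (i : ℕ)) y * wrap σ a i j) := by
  ext k
  obtain ⟨l, rfl⟩ : ∃ l, k = l + j := ⟨k - j, by simp⟩
  rw [coeff_mul_mono hσ, coeff_mono, coeff_mono]
  simp only [add_left_inj]
  split_ifs with h
  · rw [h]
  · simp

theorem wrap_zero_left (j : Fin m) : wrap σ a 0 j = 1 := by
  simp [wrap]

theorem wrap_zero_right (j : Fin m) : wrap σ a j 0 = 1 := by
  simp [wrap]

theorem mono_zero_mul (hσ : σ ^ m = 1) (k : K) (x : CyclicAlg m σ a) :
    mono 0 k * x = lmul k x := by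
  ext i
  have := coeff_mono_mul hσ x 0 i k
  rw [zero_add] at this
  rw [this, wrap_zero_left, coeff_lmul]
  simp

theorem mul_mono_zero (hσ : σ ^ m = 1) (k : K) (x : CyclicAlg m σ a) :
    x * mono 0 k = rmul k x := by
  ext i
  have := coeff_mul_mono hσ x i 0 k
  rw [add_zero] at this
  rw [this, wrap_zero_right, coeff_rmul, mul_one]

theorem mono_one_mul (hσ : σ ^ m = 1) (x : CyclicAlg m σ a) : mono 0 1 * x = x := by
  rw [mono_zero_mul hσ]; simp

theorem mul_mono_one (hσ : σ ^ m = 1) (x : CyclicAlg m σ a) : x * mono 0 1 = x := by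
  rw [mul_mono_zero hσ]; simp

theorem mono_coeff_mul_mono (hσ : σ ^ m = 1) (x : CyclicAlg m σ a) (i j : Fin m) (y : K) :
    (mono i (x.coeff i) * mono j y : CyclicAlg m σ a) =
      mono (i + j) ((x * mono j y).coeff (i + j)) := by
  rw [mono_mul_mono hσ, coeff_mul_mono hσ]

theorem mono_mul_mono_coeff (hσ : σ ^ m = 1) (y : CyclicAlg m σ a) (i j : Fin m) (x : K) :
    (mono i x * mono j (y.coeff j) : CyclicAlg m σ a) =
      mono (i + j) ((mono i x * y).coeff (i + j)) := by
  rw [mono_mul_mono hσ, coeff_mono_mul hσ]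

theorem mono_assoc (hσ : σ ^ m = 1) (p q r : Fin m) (x y z : K) (h : (p : ℕ) + q < m) :
    (mono p x * mono q y * mono r z : CyclicAlg m σ a) = mono p x * (mono q y * mono r z) := by
  have hw := wrap_cocycle (a := a) hσ p q r
  rw [if_pos h, if_pos h, mul_one, mul_one] at hw
  simp only [mono_mul_mono hσ, map_mul, pow_val_add hσ, AlgEquiv.mul_apply, add_assoc]
  congr 1
  linear_combination x * (σ ^ (p : ℕ)) y * (σ ^ (p : ℕ)) ((σ ^ (q : ℕ)) z) * hw

/-- If `a` is fixed by no `σ^r` with `r ≠ 0`, then monomials of degrees `p`, `q`, `r` associate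
only for trivial reasons. -/
theorem eq_zero_of_mono_assoc (hσ : σ ^ m = 1)
    (ha : ∀ r : Fin m, r ≠ 0 → (σ ^ (r : ℕ)) a ≠ a) {p q r : Fin m} (h : m ≤ (p : ℕ) + q)
    (hr : r ≠ 0) {x y z : K}
    (hxyz : (mono p x * mono q y * mono r z : CyclicAlg m σ a) =
      mono p x * (mono q y * mono r z)) : x = 0 ∨ y = 0 ∨ z = 0 := by
  by_contra! hne
  obtain ⟨hx, hy, hz⟩ := hne
  have ha0 : a ≠ 0 := by
    rintro rfl
    exact ha r hr (map_zero _)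
  have hw := wrap_cocycle (a := a) hσ p q r
  have hwne : ∀ i j : Fin m, wrap σ a i j ≠ 0 := by
    intro i j
    unfold wrap
    split_ifs
    · exact one_ne_zero
    · exact (map_ne_zero _).2 ha0
  rw [if_neg (by omega), if_neg (by omega)] at hw
  simp only [mono_mul_mono hσ, map_mul, pow_val_add hσ, AlgEquiv.mul_apply, add_assoc] at hxyz
  have h2 := mono_injective _ hxyz
  have hs : ∀ (n : ℕ) {w : K}, w ≠ 0 → (σ ^ n) w ≠ 0 := fun n w hw => (map_ne_zero _).2 hw
  have h3 : wrap σ a p q * wrap σ a (p + q) r =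
      (σ ^ (p : ℕ)) (wrap σ a q r) * wrap σ a p (q + r) := by
    have : x * (σ ^ (p : ℕ)) y * (σ ^ (p : ℕ)) ((σ ^ (q : ℕ)) z) ≠ 0 :=
      mul_ne_zero (mul_ne_zero hx (hs _ hy)) (hs _ (hs _ hz))
    apply mul_left_cancel₀ this
    linear_combination h2
  rw [h3] at hw
  have h4 := mul_left_cancel₀ (mul_ne_zero (hs _ (hwne _ _)) (hwne _ _)) hw
  rw [pow_add, AlgEquiv.mul_apply] at h4
  exact ha r hr ((σ ^ ((p : ℕ) + q)).injective h4)

end Monomials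

end CyclicAlg

/-! ### Generators of a cyclic Galois group -/

section Cyclic

variable {F K : Type*} [Field F] [Field K] [Algebra F K] [FiniteDimensional F K] [IsGalois F K]
  {σ : K ≃ₐ[F] K}

theorem IsGalGenerator.orderOf_eq (hσ : IsGalGenerator σ) : orderOf σ = Module.finrank F K := by
  rw [orderOf_eq_card_of_forall_mem_zpowers hσ, IsGalois.card_aut_eq_finrank]

theorem IsGalGenerator.pow_finrank (hσ : IsGalGenerator σ) : σ ^ Module.finrank F K = 1 := by
  rw [← hσ.orderOf_eq, pow_orderOf_eq_one]

theorem IsGalGenerator.bijective_pow (hσ : IsGalGenerator σ) :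
    Function.Bijective fun j : Fin (Module.finrank F K) => σ ^ (j : ℕ) := by
  have hinj : Function.Injective fun j : Fin (Module.finrank F K) => σ ^ (j : ℕ) := by
    intro i j h
    refine Fin.ext (pow_injOn_Iio_orderOf ?_ ?_ h) <;>
    · rw [hσ.orderOf_eq]
      exact Fin.is_lt _
  rw [Fintype.bijective_iff_injective_and_card]
  refine ⟨hinj, ?_⟩
  rw [Fintype.card_fin, ← Nat.card_eq_fintype_card, IsGalois.card_aut_eq_finrank]

theorem IsGalGenerator.mem_range_of_fixed (hσ : IsGalGenerator σ) {a : K} (h : σ a = a) :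
    a ∈ Set.range (algebraMap F K) := by
  have h0 : σ ∈ MulAction.stabilizer (K ≃ₐ[F] K) a := h
  have := (IsGalois.mem_bot_iff_fixed (F := F) a).2 fun τ =>
    (Subgroup.zpowers_le.2 h0) (hσ τ)
  exact Algebra.mem_bot.1 this

theorem IsGalGenerator.prod_pow (hσ : IsGalGenerator σ) (x : K) :
    ∏ j : Fin (Module.finrank F K), (σ ^ (j : ℕ)) x = algebraMap F K (Algebra.norm F x) := by
  rw [Algebra.norm_eq_prod_automorphisms]
  exact Fintype.prod_bijective _ hσ.bijective_pow _ _ fun _ => rfl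

omit [FiniteDimensional F K] [IsGalois F K] in
theorem IsGalGenerator.mul_comm (hσ : IsGalGenerator σ) (g h : K ≃ₐ[F] K) : g * h = h * g := by
  obtain ⟨i, rfl⟩ := hσ g
  obtain ⟨j, rfl⟩ := hσ h
  exact zpow_mul_comm σ i j

/-- In prime degree every nontrivial power of a generator is a generator, so that it moves every
element outside the ground field. -/
theorem IsGalGenerator.pow_apply_ne (hσ : IsGalGenerator σ) (hp : (Module.finrank F K).Prime)
    {a : K} (ha : a ∉ Set.range (algebraMap F K)) (r : Fin (Module.finrank F K)) (hr : (r : ℕ) ≠ 0) :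
    (σ ^ (r : ℕ)) a ≠ a := by
  intro h
  have hcop : (orderOf σ).Coprime r := by
    rw [hσ.orderOf_eq, Nat.Prime.coprime_iff_not_dvd hp]
    exact Nat.not_dvd_of_pos_of_lt (Nat.pos_of_ne_zero hr) r.2
  refine ha (IsGalGenerator.mem_range_of_fixed (σ := σ ^ (r : ℕ)) (fun τ => ?_) h)
  have h1 : σ ∈ Subgroup.zpowers (σ ^ (r : ℕ)) := by
    obtain ⟨k, hk⟩ := exists_pow_eq_self_of_coprime hcop.symm
    exact ⟨k, by simpa using hk⟩
  exact (Subgroup.zpowers_le.2 h1) (hσ τ)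


end Cyclic

/-- If two embeddings of `K` into an `F`-algebra satisfy `range i ≤ range j`, then they differ by an
automorphism of `K`. -/
theorem AlgHom.exists_algEquiv_of_range_le {F K E : Type*} [Field F] [Field K] [Algebra F K]
    [FiniteDimensional F K] [Ring E] [Nontrivial E] [Algebra F E] (i j : K →ₐ[F] E)
    (h : ∀ k, ∃ k', j k' = i k) : ∃ α : K ≃ₐ[F] K, ∀ k, j (α k) = i k := by
  let e := AlgEquiv.ofInjective j (j : K →+* E).injective
  let i' : K →ₐ[F] j.range := i.codRestrict _ h
  let α : K →ₐ[F] K := e.symm.toAlgHom.comp i'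
  refine ⟨AlgEquiv.ofBijective α (Algebra.IsAlgebraic.algHom_bijective α), fun k => ?_⟩
  exact congrArg Subtype.val (e.apply_symm_apply (i' k))

namespace CyclicAlg

variable {F K : Type*} [Field F] [Field K] [Algebra F K] {m : ℕ} [NeZero m]
  {σ : K ≃ₐ[F] K} {a : K}

/-! ### Nuclei -/

section Nuclei

theorem eq_mono_zero {n : CyclicAlg m σ a} (h : ∀ i, i ≠ 0 → n.coeff i = 0) :
    n = mono 0 (n.coeff 0) := by
  ext i
  rw [coeff_mono]
  split_ifs with hi
  · rw [hi]
  · exact h i hi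

/-- The left nucleus is `K`, in the form in which it is transported by isotopisms. -/
theorem exists_lmul_of_map_mul_left (hm : 2 ≤ m) (hσ : σ ^ m = 1)
    (ha : ∀ r : Fin m, r ≠ 0 → (σ ^ (r : ℕ)) a ≠ a) {φ ψ : CyclicAlg m σ a → CyclicAlg m σ a}
    (h : ∀ x y, φ (x * y) = ψ x * y) :
    ∃ k, (∀ x, φ x = lmul k x) ∧ ∀ x, ψ x = lmul k x := by
  set n := ψ (mono 0 1) with hn
  have h1 : ∀ y, φ y = n * y := fun y => by rw [hn, ← h, mono_one_mul hσ]
  have h2 : ∀ x, ψ x = φ x := fun x => by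
    rw [← mul_mono_one hσ (ψ x), ← h, mul_mono_one hσ]
  have h3 : ∀ x y, n * x * y = n * (x * y) := fun x y => by rw [← h1, ← h1, ← h2, h]
  have h4 : n = mono 0 (n.coeff 0) := eq_mono_zero fun i hi => by
    have hi' : (i : ℕ) ≠ 0 := fun h0 => hi (Fin.ext (by simpa using h0))
    let q : Fin m := ⟨m - 1, by omega⟩
    let z : Fin m := ⟨1, by omega⟩
    have hz : z ≠ 0 := fun h0 => by simpa [z] using congrArg Fin.val h0
    have key : (mono i (n.coeff i) * mono q 1 * mono z 1 : CyclicAlg m σ a) =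
        mono i (n.coeff i) * (mono q 1 * mono z 1) := by
      rw [mono_coeff_mul_mono hσ, mono_coeff_mul_mono hσ, h3, mono_mul_mono hσ q z,
        mono_coeff_mul_mono hσ, add_assoc]
    simpa using eq_zero_of_mono_assoc hσ ha (show m ≤ (i : ℕ) + (m - 1) by omega) hz key
  refine ⟨n.coeff 0, fun x => ?_, fun x => ?_⟩
  · rw [h1, ← mono_zero_mul hσ, ← h4]
  · rw [h2, h1, ← mono_zero_mul hσ, ← h4]

/-- The middle nucleus is `K`, in the form in which it is transported by isotopisms. -/
theorem exists_rmul_lmul_of_map_mul (hm : 2 ≤ m) (hσ : σ ^ m = 1)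
    (ha : ∀ r : Fin m, r ≠ 0 → (σ ^ (r : ℕ)) a ≠ a) {φ ψ : CyclicAlg m σ a → CyclicAlg m σ a}
    (h : ∀ x y, φ x * y = x * ψ y) :
    ∃ k, (∀ x, φ x = rmul k x) ∧ ∀ x, ψ x = lmul k x := by
  set n := ψ (mono 0 1) with hn
  have h1 : ∀ x, φ x = x * n := fun x => by rw [hn, ← h, mul_mono_one hσ]
  have h2 : ∀ y, ψ y = n * y := fun y => by
    rw [← mono_one_mul hσ (ψ y), ← h, h1, mono_one_mul hσ]
  have h3 : ∀ x y, x * n * y = x * (n * y) := fun x y => by rw [← h1, ← h2, h]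
  have h4 : n = mono 0 (n.coeff 0) := eq_mono_zero fun i hi => by
    have hi' : (i : ℕ) ≠ 0 := fun h0 => hi (Fin.ext (by simpa using h0))
    let q : Fin m := ⟨m - 1, by omega⟩
    let z : Fin m := ⟨1, by omega⟩
    have hz : z ≠ 0 := fun h0 => by simpa [z] using congrArg Fin.val h0
    have key : (mono q 1 * mono i (n.coeff i) * mono z 1 : CyclicAlg m σ a) =
        mono q 1 * (mono i (n.coeff i) * mono z 1) := by
      rw [mono_mul_mono_coeff hσ, mono_coeff_mul_mono hσ, h3, mono_coeff_mul_mono hσ,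
        mono_mul_mono_coeff hσ, add_assoc]
    simpa using eq_zero_of_mono_assoc hσ ha (show m ≤ (m - 1) + (i : ℕ) by omega) hz key
  refine ⟨n.coeff 0, fun x => ?_, fun x => ?_⟩
  · rw [h1, ← mul_mono_zero hσ, ← h4]
  · rw [h2, ← mono_zero_mul hσ, ← h4]

/-- The right nucleus is `K`, in the form in which it is transported by isotopisms. -/
theorem exists_rmul_of_map_mul_right (hm : 2 ≤ m) (hσ : σ ^ m = 1)
    (ha : ∀ r : Fin m, r ≠ 0 → (σ ^ (r : ℕ)) a ≠ a) {φ ψ : CyclicAlg m σ a → CyclicAlg m σ a}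
    (h : ∀ x y, φ (x * y) = x * ψ y) :
    ∃ k, (∀ x, φ x = rmul k x) ∧ ∀ x, ψ x = rmul k x := by
  set n := ψ (mono 0 1) with hn
  have h1 : ∀ x, φ x = x * n := fun x => by rw [hn, ← h, mul_mono_one hσ]
  have h2 : ∀ y, ψ y = φ y := fun y => by
    rw [← mono_one_mul hσ (ψ y), ← h, mono_one_mul hσ]
  have h3 : ∀ x y, x * y * n = x * (y * n) := fun x y => by rw [← h1, ← h1, ← h2 y, h]
  have h4 : n = mono 0 (n.coeff 0) := eq_mono_zero fun i hi => by
    let q : Fin m := ⟨m - 1, by omega⟩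
    let z : Fin m := ⟨1, by omega⟩
    have key : (mono z 1 * mono q 1 * mono i (n.coeff i) : CyclicAlg m σ a) =
        mono z 1 * (mono q 1 * mono i (n.coeff i)) := by
      rw [mono_mul_mono_coeff hσ n q i, mono_mul_mono_coeff hσ _ z, mono_mul_mono hσ z q,
        mono_mul_mono_coeff hσ, ← mono_mul_mono hσ, h3, add_assoc]
    simpa using eq_zero_of_mono_assoc hσ ha (show m ≤ 1 + (m - 1) by omega) hi key
  refine ⟨n.coeff 0, fun x => ?_, fun x => ?_⟩
  · rw [h1, ← mul_mono_zero hσ, ← h4]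
  · rw [h2, h1, ← mul_mono_zero hσ, ← h4]

theorem not_assoc (hm : 2 ≤ m) (hσ : σ ^ m = 1)
    (ha : ∀ r : Fin m, r ≠ 0 → (σ ^ (r : ℕ)) a ≠ a) :
    ¬ ∀ x y z : CyclicAlg m σ a, x * y * z = x * (y * z) := by
  intro h
  let q : Fin m := ⟨m - 1, by omega⟩
  let z : Fin m := ⟨1, by omega⟩
  have hz : z ≠ 0 := fun h0 => by simpa [z] using congrArg Fin.val h0
  have := eq_zero_of_mono_assoc hσ ha (show m ≤ (z : ℕ) + (q : ℕ) by simp only [z, q]; omega) hz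
    (h (mono z 1) (mono q 1) (mono z 1))
  simp at this

end Nuclei

/-! ### Semilinearity of isotopisms -/

section Isotopy

variable [FiniteDimensional F K] {σ' : K ≃ₐ[F] K} {a' : K}

instance : Nontrivial (CyclicAlg m σ a) := ⟨mono 0 1, 0, mono_ne_zero 0 one_ne_zero⟩

/-- An isotopism is semilinear for the left nuclei. -/
theorem exists_algEquiv_left (hm : 2 ≤ m) (hσ : σ ^ m = 1) (hσ' : σ' ^ m = 1)
    (ha' : ∀ r : Fin m, r ≠ 0 → (σ' ^ (r : ℕ)) a' ≠ a')
    {f g H : CyclicAlg m σ a ≃ₗ[F] CyclicAlg m σ' a'} (hH : ∀ x y, H (x * y) = f x * g y) :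
    ∃ α : K ≃ₐ[F] K, (∀ k x, f (lmul k x) = lmul (α k) (f x)) ∧
      ∀ k x, H (lmul k x) = lmul (α k) (H x) := by
  have h : ∀ k, ∃ k', (∀ x, H (lmul k (H.symm x)) = lmul k' x) ∧
      ∀ x, f (lmul k (f.symm x)) = lmul k' x := by
    intro k
    refine exists_lmul_of_map_mul_left hm hσ' ha' fun x y => ?_
    obtain ⟨x, rfl⟩ := f.surjective x
    obtain ⟨y, rfl⟩ := g.surjective y
    rw [← hH, H.symm_apply_apply, f.symm_apply_apply, ← lmul_mul hσ, hH]
  choose κ hκH hκf using h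
  obtain ⟨α, hα⟩ := AlgHom.exists_algEquiv_of_range_le
    ((f.conjAlgEquiv F).toAlgHom.comp lmul) lmul
    fun k => ⟨κ k, LinearMap.ext fun x => (hκf k x).symm⟩
  have hακ : ∀ k, (lmul (α k) : Module.End F (CyclicAlg m σ' a')) = lmul (κ k) := fun k =>
    (hα k).trans (LinearMap.ext fun x => hκf k x)
  refine ⟨α, fun k x => ?_, fun k x => ?_⟩
  · rw [hακ, ← hκf, f.symm_apply_apply]
  · rw [hακ, ← hκH, H.symm_apply_apply]

/-- An isotopism is semilinear for the middle nuclei. -/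
theorem exists_algEquiv_middle (hm : 2 ≤ m) (hσ : σ ^ m = 1) (hσ' : σ' ^ m = 1)
    (ha' : ∀ r : Fin m, r ≠ 0 → (σ' ^ (r : ℕ)) a' ≠ a')
    {f g H : CyclicAlg m σ a ≃ₗ[F] CyclicAlg m σ' a'} (hH : ∀ x y, H (x * y) = f x * g y) :
    ∃ γ : K ≃ₐ[F] K, (∀ k x, f (rmul k x) = rmul (γ k) (f x)) ∧
      ∀ k x, g (lmul k x) = lmul (γ k) (g x) := by
  have h : ∀ k, ∃ k', (∀ x, f (rmul k (f.symm x)) = rmul k' x) ∧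
      ∀ x, g (lmul k (g.symm x)) = lmul k' x := by
    intro k
    refine exists_rmul_lmul_of_map_mul hm hσ' ha' fun x y => ?_
    obtain ⟨x, rfl⟩ := f.surjective x
    obtain ⟨y, rfl⟩ := g.surjective y
    rw [g.symm_apply_apply, f.symm_apply_apply, ← hH, ← hH, rmul_mul hσ]
  choose κ hκf hκg using h
  obtain ⟨γ, hγ⟩ := AlgHom.exists_algEquiv_of_range_le
    ((g.conjAlgEquiv F).toAlgHom.comp lmul) lmul
    fun k => ⟨κ k, LinearMap.ext fun x => (hκg k x).symm⟩
  have hγκ : ∀ k, γ k = κ k := fun k =>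
    (lmul : K →ₐ[F] Module.End F (CyclicAlg m σ' a')).toRingHom.injective
      ((hγ k).trans (LinearMap.ext fun x => hκg k x))
  refine ⟨γ, fun k x => ?_, fun k x => ?_⟩
  · rw [hγκ, ← hκf, f.symm_apply_apply]
  · rw [hγκ, ← hκg, g.symm_apply_apply]

/-- An isotopism is semilinear for the right nuclei. -/
theorem exists_algEquiv_right (hm : 2 ≤ m) (hσ : σ ^ m = 1) (hσ' : σ' ^ m = 1)
    (ha' : ∀ r : Fin m, r ≠ 0 → (σ' ^ (r : ℕ)) a' ≠ a')
    {f g H : CyclicAlg m σ a ≃ₗ[F] CyclicAlg m σ' a'} (hH : ∀ x y, H (x * y) = f x * g y) :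
    ∃ δ : K ≃ₐ[F] K, ∀ k x, g (rmul k x) = rmul (δ k) (g x) := by
  have h : ∀ k, ∃ k', (∀ x, H (rmul k (H.symm x)) = rmul k' x) ∧
      ∀ x, g (rmul k (g.symm x)) = rmul k' x := by
    intro k
    refine exists_rmul_of_map_mul_right hm hσ' ha' fun x y => ?_
    obtain ⟨x, rfl⟩ := f.surjective x
    obtain ⟨y, rfl⟩ := g.surjective y
    rw [← hH, H.symm_apply_apply, g.symm_apply_apply, ← mul_rmul hσ, hH]
  choose κ _ hκg using h
  obtain ⟨δ, hδ⟩ := AlgHom.exists_algEquiv_of_range_le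
    ((g.conjAlgEquiv F).toAlgHom.comp rmul) rmul
    fun k => ⟨κ k, LinearMap.ext fun x => (hκg k x).symm⟩
  refine ⟨δ, fun k x => ?_⟩
  rw [hδ, AlgHom.comp_apply]
  exact congrArg (fun z => g (rmul k z)) (g.symm_apply_apply x).symm

omit [NeZero m] [FiniteDimensional F K] in
/-- A linear map that is semilinear on both sides permutes the lines `K t^i`: these are the
isotypic components of the algebra as a `K`-`K`-bimodule. -/
theorem exists_map_mono (hinj : Function.Injective fun j : Fin m => σ' ^ (j : ℕ))
    {f : CyclicAlg m σ a ≃ₗ[F] CyclicAlg m σ' a'} {α γ : K ≃ₐ[F] K}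
    (hl : ∀ k x, f (lmul k x) = lmul (α k) (f x)) (hr : ∀ k x, f (rmul k x) = rmul (γ k) (f x))
    (i : Fin m) :
    ∃ (j : Fin m) (u : K), u ≠ 0 ∧ f (mono i 1) = mono j u ∧
      σ' ^ (j : ℕ) * γ = α * σ ^ (i : ℕ) := by
  set y := f (mono i 1) with hy
  have hy0 : y ≠ 0 := (map_ne_zero_iff f f.injective).2 (mono_ne_zero i one_ne_zero)
  have hk : ∀ k, rmul (γ k) y = lmul (α ((σ ^ (i : ℕ)) k)) y := fun k => by
    rw [hy, ← hr, ← hl, rmul_mono, lmul_mono, one_mul, mul_one]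
  have hj : ∀ j, y.coeff j ≠ 0 → σ' ^ (j : ℕ) * γ = α * σ ^ (i : ℕ) := by
    intro j hj
    ext k
    have := congrArg (fun z => z.coeff j) (hk k)
    simp only [coeff_rmul, coeff_lmul] at this
    rw [mul_comm] at this
    exact mul_right_cancel₀ hj this
  obtain ⟨j, hj0⟩ : ∃ j, y.coeff j ≠ 0 := by
    by_contra! h
    exact hy0 (by ext j; simp [h, coeff_zero])
  refine ⟨j, y.coeff j, hj0, ?_, hj j hj0⟩
  ext l
  rw [coeff_mono]
  split_ifs with h
  · rw [h]
  · by_contra hl0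
    exact h (hinj (mul_right_cancel ((hj l hl0).trans (hj j hj0).symm)))

end Isotopy

end CyclicAlg

namespace CyclicAlg

/-! ### What isotopy and isomorphism preserve -/

section Invariants

variable {F K : Type*} [Field F] [Field K] [Algebra F K] {m : ℕ}
  {σ : K ≃ₐ[F] K} {a : K}

/-- The number of `j < m` for which `t^i t^j` is reduced modulo `t^m - a` is `i`. -/
theorem prod_ite_add_lt {M : Type*} [CommMonoid M] (i : Fin m) (A : M) :
    (∏ j : Fin m, if (i : ℕ) + j < m then 1 else A) = A ^ (i : ℕ) := by
  rw [Fin.prod_univ_eq_prod_range (fun j => if (i : ℕ) + j < m then 1 else A),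
    Finset.prod_ite, Finset.prod_const_one, one_mul, Finset.prod_const]
  congr 1
  have : (Finset.range m).filter (fun j => ¬ (i : ℕ) + j < m) = Finset.Ico (m - i) m := by
    ext j
    simp only [Finset.mem_filter, Finset.mem_range, Finset.mem_Ico]
    omega
  rw [this, Nat.card_Ico]
  omega

/-- Taking the product over `j` of the structure equations of a monomial isotopism, after
normalizing by the Galois action, eliminates `v` and `w` up to constants independent of `i`. -/
theorem exists_const_mul_pow_eq [NeZero m] [FiniteDimensional F K] [IsGalois F K]
    (hK : Module.finrank F K = m)
    (hσ : IsGalGenerator σ) {a' : K} {α : K ≃ₐ[F] K} {u v w : Fin m → K} {r s : Fin m}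
    (hv : ∀ i, v i ≠ 0) (hw : ∀ i, w i ≠ 0)
    (h : ∀ i j, α (wrap σ a i j) * w (i + j) =
      u i * (σ ^ ((i + r : Fin m) : ℕ)) (v j) * wrap σ a' (i + r) (j + s)) :
    ∃ W V : K, W ≠ 0 ∧ V ≠ 0 ∧ ∀ i : Fin m, W * (α a) ^ (i : ℕ) =
      algebraMap F K (Algebra.norm F (u i)) * V *
        ((σ ^ ((r + s : Fin m) : ℕ)) a') ^ ((i + r : Fin m) : ℕ) := by
  have hσm : σ ^ m = 1 := by
    subst hK
    exact hσ.pow_finrank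
  have hpow : Function.Bijective fun j : Fin m => σ ^ (j : ℕ) := by
    subst hK
    exact hσ.bijective_pow
  set G : Fin (m) → (K ≃ₐ[F] K) := fun k => σ ^ (k : ℕ) with hG
  have hadd : ∀ i j, G (i + j) = G i * G j := pow_val_add hσm
  have hcancel : ∀ (g : K ≃ₐ[F] K) (x : K), g⁻¹ (g x) = x := fun g x => g.symm_apply_apply x
  have hwrap : ∀ (b : K) (i j : Fin (m)),
      wrap σ b i j = if (i : ℕ) + j < m then 1 else G (i + j) b := by
    intro b i j
    rw [wrap, hadd, pow_add]
  refine ⟨∏ k, (G k)⁻¹ (w k), ∏ j, (G r) ((G j)⁻¹ (v j)),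
    Finset.prod_ne_zero_iff.2 fun k _ => (map_ne_zero _).2 (hw k),
    Finset.prod_ne_zero_iff.2 fun k _ => (map_ne_zero _).2 ((map_ne_zero _).2 (hv k)), fun i => ?_⟩
  have hbij : Function.Bijective fun j => (G (i + j))⁻¹ :=
    (Equiv.inv (K ≃ₐ[F] K)).bijective.comp (hpow.comp (Equiv.addLeft i).bijective)
  have hstep : ∀ j : Fin m, (if (i : ℕ) + j < m then 1 else α a) *
      (G (i + j))⁻¹ (w (i + j)) = (G (i + j))⁻¹ (u i) * (G r) ((G j)⁻¹ (v j)) *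
      (if ((i + r : Fin m) : ℕ) + (j + s : Fin m) < m then 1
        else G (r + s) a') := by
    intro j
    have h1 := congrArg (fun x => (G (i + j))⁻¹ x) (h i j)
    rw [map_mul, map_mul, map_mul, hwrap, hwrap] at h1
    have e1 : (G (i + j))⁻¹ (α (if (i : ℕ) + j < m then 1 else G (i + j) a)) =
        if (i : ℕ) + j < m then 1 else α a := by
      split_ifs
      · rw [map_one, map_one]
      · rw [← AlgEquiv.mul_apply α, hσ.mul_comm α, AlgEquiv.mul_apply, hcancel]
    have e2 : (G (i + j))⁻¹ ((σ ^ ((i + r : Fin m) : ℕ)) (v j)) = (G r) ((G j)⁻¹ (v j)) := by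
      change (G (i + j))⁻¹ (G (i + r) (v j)) = _
      rw [← AlgEquiv.mul_apply, ← AlgEquiv.mul_apply, hadd, hadd, mul_inv_rev, mul_assoc,
        inv_mul_cancel_left, hσ.mul_comm]
    have e3 : (G (i + j))⁻¹ (if ((i + r : Fin m) : ℕ) + (j + s : Fin m) < m then 1
        else G (i + r + (j + s)) a') =
        if ((i + r : Fin m) : ℕ) + (j + s : Fin m) < m then 1
        else G (r + s) a' := by
      split_ifs
      · rw [map_one]
      · rw [show i + r + (j + s) = (i + j) + (r + s) by abel, hadd (i + j), AlgEquiv.mul_apply, hcancel]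
    rwa [e1, e2, e3] at h1
  have hprod := Finset.prod_congr (rfl : (Finset.univ : Finset (Fin (m))) = _)
    fun j _ => hstep j
  simp only [Finset.prod_mul_distrib] at hprod
  have p1 : ∏ j, (G (i + j))⁻¹ (w (i + j)) = ∏ k, (G k)⁻¹ (w k) :=
    Fintype.prod_equiv (Equiv.addLeft i) _ _ fun _ => rfl
  have p2 : (∏ j : Fin m, if ((i + r : Fin m) : ℕ) + (j + s : Fin m) < m then 1
      else G (r + s) a') = (G (r + s) a') ^ ((i + r : Fin m) : ℕ) := by
    rw [← prod_ite_add_lt]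
    exact Fintype.prod_equiv (Equiv.addRight s) _ _ fun _ => rfl
  have p3 : ∏ j, (G (i + j))⁻¹ (u i) = algebraMap F K (Algebra.norm F (u i)) := by
    rw [Algebra.norm_eq_prod_automorphisms]
    exact Fintype.prod_bijective _ hbij _ _ fun _ => rfl
  rw [prod_ite_add_lt, p1, p2, p3] at hprod
  rw [mul_comm, hprod]

/-- Isotopic algebras with the same generator have Galois conjugate parameters, up to a factor
from the ground field. -/
theorem exists_algEquiv_apply_eq_of_algIsotopic [FiniteDimensional F K] [IsGalois F K]
    (hK : Module.finrank F K = m) (hp : m.Prime) (hm : m ≠ 2) (hσ : IsGalGenerator σ) {a' : K}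
    (ha' : a' ∉ Set.range (algebraMap F K))
    (h : AlgIsotopic F (CyclicAlg m σ a) (CyclicAlg m σ a')) :
    ∃ (ρ : K ≃ₐ[F] K) (n : F), n ≠ 0 ∧ ρ a = algebraMap F K n * a' := by
  have hm2 := hp.two_le
  have : NeZero m := ⟨by omega⟩
  have hfix : ∀ r : Fin m, r ≠ 0 → (σ ^ (r : ℕ)) a' ≠ a' := by
    subst hK
    exact fun r hr => hσ.pow_apply_ne hp ha' r fun h0 => hr (Fin.ext (by simpa using h0))
  have hinj : Function.Injective fun j : Fin m => σ ^ (j : ℕ) := by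
    subst hK
    exact hσ.bijective_pow.1
  have hσm : σ ^ m = 1 := by
    subst hK
    exact hσ.pow_finrank
  obtain ⟨f, g, h', hfgh⟩ := h
  have hH : ∀ x y, h'.symm (x * y) = f x * g y := fun x y => by
    rw [hfgh, h'.symm_apply_apply]
  generalize h'.symm = H at hH
  obtain ⟨α, hfl, hHl⟩ := exists_algEquiv_left hm2 hσm hσm hfix hH
  obtain ⟨γ, hfr, hgl⟩ := exists_algEquiv_middle hm2 hσm hσm hfix hH
  obtain ⟨δ, hgr⟩ := exists_algEquiv_right hm2 hσm hσm hfix hH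
  choose jf u hu hfu hjf using exists_map_mono hinj hfl hfr
  choose jg v hv hgv hjg using exists_map_mono hinj hgl hgr
  -- both index maps are translations, because the Galois group is commutative
  have trans : ∀ {j : Fin m → Fin m} {μ ν : K ≃ₐ[F] K},
      (∀ i, σ ^ (j i : ℕ) * ν = μ * σ ^ (i : ℕ)) → ∀ i, j i = i + j 0 := by
    intro j μ ν hj i
    apply hinj
    change σ ^ (j i : ℕ) = σ ^ ((i + j 0 : Fin m) : ℕ)
    have h0 := hj 0
    rw [Fin.val_zero, pow_zero, mul_one] at h0
    rw [pow_val_add hσm]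
    apply mul_right_cancel (b := ν)
    rw [hj, mul_assoc, h0, hσ.mul_comm]
  have hf := trans hjf
  have hg := trans hjg
  set r := jf 0
  set s := jg 0
  let w : Fin m → K := fun k => u k * (σ ^ ((k + r : Fin m) : ℕ)) (v 0) * wrap σ a' (k + r) s
  have hHw : ∀ k, H (mono k 1) = mono (k + r + s) (w k) := fun k => by
    rw [← mul_mono_one hσm (mono k 1), hH, hfu, hgv, hf, hg 0, zero_add, mono_mul_mono hσm]
  have hw : ∀ k, w k ≠ 0 := fun k hk => by
    have := hHw k
    rw [hk, mono_zero] at this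
    exact (map_ne_zero_iff H H.injective).2 (mono_ne_zero k one_ne_zero) this
  obtain ⟨W, V, hW, hV, hWV⟩ := exists_const_mul_pow_eq (a := a) (a' := a') (α := α) (u := u)
    (v := v) (w := w) (r := r) (s := s) hK hσ hv hw (fun i j => by
      have h1 : H (mono i 1 * mono j 1) = H (lmul (wrap σ a i j) (mono (i + j) 1)) := by
        rw [mono_mul_mono hσm, lmul_mono, map_one, one_mul, one_mul, mul_one]
      rw [hH, hHl, hfu, hgv, hf, hg, hHw, lmul_mono, mono_mul_mono hσm,
        show i + r + (j + s) = i + j + r + s by abel] at h1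
      exact (mono_injective _ h1).symm)
  set B := (σ ^ ((r + s : Fin m) : ℕ)) a' with hB
  -- two consecutive exponents, neither of which wraps around on either side
  obtain ⟨i, i', hi, hir⟩ : ∃ i i' : Fin m, (i' : ℕ) = i + 1 ∧
      ((i' + r : Fin m) : ℕ) = (i + r : Fin m) + 1 := by
    by_cases hr : (r : ℕ) + 1 < m
    · refine ⟨⟨0, by omega⟩, ⟨1, by omega⟩, rfl, ?_⟩
      rw [Fin.val_add, Fin.val_add, Nat.mod_eq_of_lt (by simp only; omega),
        Nat.mod_eq_of_lt (by simp only; omega)]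
      simp only
      omega
    · have hr' : (r : ℕ) = m - 1 := by omega
      refine ⟨⟨1, by omega⟩, ⟨2, by omega⟩, rfl, ?_⟩
      have e0 : (1 + (m - 1)) % m = 0 := by
        rw [show 1 + (m - 1) = m by omega, Nat.mod_self]
      have e1 : (2 + (m - 1)) % m = 1 := by
        rw [show 2 + (m - 1) = 1 + m by omega, Nat.add_mod_right, Nat.mod_eq_of_lt (by omega)]
      rw [Fin.val_add, Fin.val_add, hr', e0, e1]
  have h1 := hWV i
  have h2 := hWV i'
  rw [hi, hir, pow_succ, pow_succ] at h2
  have hB0 : B ≠ 0 := (map_ne_zero _).2 (by rintro rfl; exact ha' ⟨0, map_zero _⟩)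
  have hN : ∀ j, algebraMap F K (Algebra.norm F (u j)) ≠ 0 := fun j =>
    (map_ne_zero _).2 (Algebra.norm_ne_zero_iff.2 (hu j))
  have hA : α a = algebraMap F K (Algebra.norm F (u i') / Algebra.norm F (u i)) * B := by
    rw [map_div₀, div_mul_eq_mul_div, eq_div_iff (hN i)]
    have hne : V * B ^ ((i + r : Fin m) : ℕ) ≠ 0 := mul_ne_zero hV (pow_ne_zero _ hB0)
    apply mul_left_cancel₀ hne
    linear_combination h2 - α a * h1
  refine ⟨(σ ^ ((r + s : Fin m) : ℕ))⁻¹ * α, Algebra.norm F (u i') / Algebra.norm F (u i),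
    div_ne_zero (Algebra.norm_ne_zero_iff.2 (hu i')) (Algebra.norm_ne_zero_iff.2 (hu i)), ?_⟩
  rw [AlgEquiv.mul_apply, hA, map_mul, AlgEquiv.commutes]
  congr 1
  exact AlgEquiv.symm_apply_apply _ a'

/-- The isomorphism class determines the generator: an isomorphism can only permute the degrees
trivially, because products of low degree associate. -/
theorem eq_of_algIsomorphic [FiniteDimensional F K] [IsGalois F K]
    (hK : Module.finrank F K = m) (hp : m.Prime) {σ' : K ≃ₐ[F] K}
    (hσ : IsGalGenerator σ) (hσ' : IsGalGenerator σ') {a' : K}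
    (ha' : a' ∉ Set.range (algebraMap F K))
    (h : AlgIsomorphic F (CyclicAlg m σ a) (CyclicAlg m σ' a')) : σ = σ' := by
  have hm2 := hp.two_le
  have : NeZero m := ⟨by omega⟩
  have hfix : ∀ r : Fin m, r ≠ 0 → (σ' ^ (r : ℕ)) a' ≠ a' := by
    subst hK
    exact fun r hr => hσ'.pow_apply_ne hp ha' r fun h0 => hr (Fin.ext (by simpa using h0))
  have hinj : Function.Injective fun j : Fin m => σ ^ (j : ℕ) := by
    subst hK
    exact hσ.bijective_pow.1
  have hinj' : Function.Injective fun j : Fin m => σ' ^ (j : ℕ) := by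
    subst hK
    exact hσ'.bijective_pow.1
  have hσm : σ ^ m = 1 := by
    subst hK
    exact hσ.pow_finrank
  have hσm' : σ' ^ m = 1 := by
    subst hK
    exact hσ'.pow_finrank
  obtain ⟨f, hf⟩ := h
  obtain ⟨γ, hfr, hfl⟩ := exists_algEquiv_middle hm2 hσm hσm' hfix hf
  choose j u hu hfu hj using exists_map_mono hinj' hfl hfr
  have hj' : ∀ i, σ' ^ (j i : ℕ) = σ ^ (i : ℕ) := fun i =>
    mul_right_cancel ((hj i).trans (hσ.mul_comm _ _))
  have hjinj : Function.Injective j := fun i i' hii => hinj (by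
    change σ ^ (i : ℕ) = σ ^ (i' : ℕ)
    rw [← hj', ← hj', hii])
  let z : Fin m := ⟨1, by omega⟩
  let l : Fin m := ⟨m - 1, by omega⟩
  obtain ⟨q, hq⟩ := (Finite.injective_iff_surjective.1 hjinj) l
  have hjz : j z ≠ 0 := fun h0 => by
    have h1 := hj' z
    rw [h0] at h1
    have := congrArg Fin.val (@hinj z 0 (by simpa using h1.symm))
    simp [z] at this
  have hql : q = l := by
    by_contra hne
    have hlt : (z : ℕ) + q < m := by
      have h1 := q.2
      have h2 : (q : ℕ) ≠ m - 1 := fun h2 => hne (Fin.ext h2)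
      simp only [z]
      omega
    -- `t, t^q, t` associate, while their images have degrees `j`, `m - 1`, `j` with `j ≠ 0`
    have h1 := congrArg f (mono_assoc (a := a) hσm z q z 1 1 1 hlt)
    rw [hf, hf, hf, hf, hfu, hfu, hq] at h1
    have h3 : (j z : ℕ) ≠ 0 := fun h0 => hjz (Fin.ext (by simpa using h0))
    rcases eq_zero_of_mono_assoc hσm' hfix (show m ≤ (j z : ℕ) + l by simp only [l]; omega)
      hjz h1 with h2 | h2 | h2
    · exact hu _ h2
    · exact hu _ h2
    · exact hu _ h2
  have h1 := hj' q
  rw [hq, hql] at h1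
  apply mul_left_cancel (a := σ ^ (m - 1))
  rw [pow_sub_one_mul (by omega), hσm]
  rw [show σ ^ (m - 1) = σ' ^ (m - 1) from h1.symm, pow_sub_one_mul (by omega), hσm']

end Invariants

/-! ### Construction of isomorphisms -/

section Construction

variable {F K L : Type*} [Field F] [Field K] [Algebra F K] [Field L] [Algebra F L] {m : ℕ}

/-- Parameters that agree up to a norm `N(p)`, after transport along an isomorphism `e` that
intertwines the generators, give isomorphic algebras: extend `e` by `t ↦ p t`. -/
theorem algIsomorphic_of_apply_eq [FiniteDimensional F K] [IsGalois F K]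
    (hK : Module.finrank F K = m) {τ : L ≃ₐ[F] L} {σ : K ≃ₐ[F] K} (hσ : IsGalGenerator σ)
    (e : L ≃ₐ[F] K) (he : ∀ x, e (τ x) = σ (e x)) {c : L} {a p : K} (hp : p ≠ 0)
    (hc : e c = algebraMap F K (Algebra.norm F p) * a) :
    AlgIsomorphic F (CyclicAlg m τ c) (CyclicAlg m σ a) := by
  have hσm : σ ^ m = 1 := by
    subst hK
    exact hσ.pow_finrank
  have hpow : ∀ (n : ℕ) (x : L), e ((τ ^ n) x) = (σ ^ n) (e x) := by
    intro n
    induction n with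
    | zero => intro x; rfl
    | succ n ih =>
      intro x
      rw [pow_succ, pow_succ, AlgEquiv.mul_apply, AlgEquiv.mul_apply, ih, he]
  have hτm : τ ^ m = 1 := by
    ext x
    apply e.injective
    rw [hpow, hσm]
    rfl
  -- `U n` is the coefficient of the `n`-th power of `p t`
  let U : ℕ → K := fun n => ∏ l ∈ Finset.range n, (σ ^ l) p
  have hU0 : ∀ n, U n ≠ 0 := fun n => Finset.prod_ne_zero_iff.2 fun l _ => (map_ne_zero _).2 hp
  have hUadd : ∀ i j, U (i + j) = U i * (σ ^ i) (U j) := by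
    intro i j
    simp only [U]
    rw [Finset.prod_range_add, map_prod]
    simp only [pow_add, AlgEquiv.mul_apply]
  have hUm : U m = algebraMap F K (Algebra.norm F p) := by
    subst hK
    rw [← hσ.prod_pow, Fin.prod_univ_eq_prod_range fun l => (σ ^ l) p]
  let φ : CyclicAlg m τ c ≃ₗ[F] CyclicAlg m σ a :=
    { toFun := fun x => ⟨fun i => e (x.coeff i) * U i⟩
      invFun := fun y => ⟨fun i => e.symm (y.coeff i * (U i)⁻¹)⟩
      map_add' := fun x y => by ext i; simp [coeff_add, add_mul]
      map_smul' := fun r x => by ext i; simp [coeff_smul]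
      left_inv := fun x => by ext i; simp [hU0]
      right_inv := fun y => by ext i; simp [hU0] }
  have hφ : ∀ x i, (φ x).coeff i = e (x.coeff i) * U i := fun _ _ => rfl
  refine ⟨φ, fun x y => ?_⟩
  ext k
  rw [hφ, coeff_mul_eq_sum hτm, coeff_mul_eq_sum hσm, map_sum, Finset.sum_mul]
  refine Finset.sum_congr rfl fun i _ => ?_
  rw [map_sum, Finset.sum_mul]
  refine Finset.sum_congr rfl fun j _ => ?_
  rw [hφ, hφ]
  split_ifs with hij
  · have hw : e (wrap τ c i j) * U k = U i * (σ ^ (i : ℕ)) (U j) * wrap σ a i j := by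
      rw [← hUadd, ← hij, Fin.val_add, wrap, wrap]
      split_ifs with hlt
      · rw [Nat.mod_eq_of_lt hlt]; simp
      · have hi := i.2
        have hj := j.2
        rw [Nat.mod_eq_sub_mod (by omega), Nat.mod_eq_of_lt (by omega), hpow, hc, map_mul,
          AlgEquiv.commutes]
        conv_rhs => rw [show (i : ℕ) + j = m + (i + j - m) by omega, hUadd, hUm, hσm]
        rw [show m + ((i : ℕ) + j - m) = i + j by omega, AlgEquiv.one_apply]
        ring
    rw [map_mul, map_mul, hpow, map_mul]
    linear_combination e (x.coeff i) * (σ ^ (i : ℕ)) (e (y.coeff j)) * hw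
  · rw [map_zero, zero_mul]

end Construction

end CyclicAlg

theorem AlgIsomorphic.algIsotopic {F A B : Type*} [Field F]
    [NonUnitalNonAssocRing A] [Module F A] [NonUnitalNonAssocRing B] [Module F B]
    (h : AlgIsomorphic F A B) : AlgIsotopic F A B := by
  obtain ⟨φ, hφ⟩ := h
  exact ⟨φ, φ, φ.symm, fun x y => by rw [← hφ, φ.symm_apply_apply]⟩

/-! ### The parametrizing set -/

section Parameters

variable {F K : Type*} [Field F] [Field K] [Algebra F K]

theorem leadIdx_mem {I : Finset ℕ} (hI : I ≠ ∅) : leadIdx I ∈ I :=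
  Nat.sInf_mem (s := (I : Set ℕ)) (by simpa [Finset.nonempty_iff_ne_empty] using hI)

theorem leadIdx_le {I : Finset ℕ} {i : ℕ} (hi : i ∈ I) : leadIdx I ≤ i :=
  Nat.sInf_le (s := (I : Set ℕ)) hi

/-- The coefficients, in the powers of `β`, of the element of `K(I; 1)` given by a tuple `t`. -/
noncomputable def repCoeff {I : Finset ℕ} (t : TailTuple F I) (i : ℕ) : F :=
  if i = leadIdx I then 1 else if h : i ∈ I.erase (leadIdx I) then t ⟨i, h⟩ else 0

theorem repCoeff_leadIdx {I : Finset ℕ} (t : TailTuple F I) : repCoeff t (leadIdx I) = 1 :=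
  if_pos rfl

theorem repCoeff_of_mem {I : Finset ℕ} (t : TailTuple F I) (i : {i // i ∈ I.erase (leadIdx I)}) :
    repCoeff t i = t i := by
  rw [repCoeff, if_neg (Finset.ne_of_mem_erase i.2), dif_pos i.2]

theorem repCoeff_ne_zero_iff {I : Finset ℕ} (hI : I ≠ ∅) (t : TailTuple F I) (i : ℕ) :
    repCoeff t i ≠ 0 ↔ i ∈ I := by
  rw [repCoeff]
  split_ifs with h1 h2
  · simpa [h1] using leadIdx_mem hI
  · simpa using Finset.mem_of_mem_erase h2
  · simpa [h1] using h2

variable {m : ℕ} {β : K}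

theorem repSet_elt_eq_sum {I : Finset ℕ} (hI : I ∈ indexSets m) (t : TailTuple F I) :
    algebraMap F K 1 * β ^ leadIdx I +
      ∑ i : {i // i ∈ I.erase (leadIdx I)}, algebraMap F K (t i) * β ^ (i : ℕ) =
    ∑ i ∈ Finset.range m, algebraMap F K (repCoeff t i) * β ^ i := by
  obtain ⟨hIm, hI0, -⟩ := hI
  rw [← Finset.sum_subset hIm, ← Finset.add_sum_erase I _ (leadIdx_mem hI0), repCoeff_leadIdx,
    ← Finset.sum_coe_sort (I.erase (leadIdx I))]
  · congr 1
    exact Finset.sum_congr rfl fun i _ => by rw [repCoeff_of_mem]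
  · intro i _ hi
    rw [not_not.1 (mt (repCoeff_ne_zero_iff hI0 t i).1 hi), map_zero, zero_mul]

theorem mem_paramSet_iff {T : (I : Finset ℕ) → Set (TailTuple F I)} {x : K} :
    x ∈ paramSet m β T ↔ ∃ I ∈ indexSets m, ∃ t ∈ T I,
      x = ∑ i ∈ Finset.range m, algebraMap F K (repCoeff t i) * β ^ i := by
  constructor
  · rintro ⟨I, hI, t, ht, rfl⟩
    exact ⟨I, hI, t, ht, repSet_elt_eq_sum hI t⟩
  · rintro ⟨I, hI, t, ht, rfl⟩
    exact ⟨I, hI, t, ht, (repSet_elt_eq_sum hI t).symm⟩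

/-- The powers of `β` are eigenvectors of `σ₀` for the distinct eigenvalues `ζ^i`. -/
theorem linearIndependent_pow_of_apply_eq_mul {ζ : F} (hζ : IsPrimitiveRoot ζ m)
    {σ₀ : K ≃ₐ[F] K} (hβ : β ≠ 0) (hσβ : σ₀ β = algebraMap F K ζ * β) :
    LinearIndependent F fun i : Fin m => β ^ (i : ℕ) := by
  refine Module.End.eigenvectors_linearIndependent' (σ₀ : K →ₗ[F] K) (fun i : Fin m => ζ ^ (i : ℕ))
    (fun i j h => Fin.ext (hζ.pow_inj i.2 j.2 h)) _ fun i => ⟨?_, pow_ne_zero _ hβ⟩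
  rw [Module.End.mem_eigenspace_iff]
  change σ₀ (β ^ (i : ℕ)) = _
  rw [map_pow, hσβ, mul_pow, Algebra.smul_def, map_pow]

theorem LinearIndependent.eq_of_sum_range_eq
    (h : LinearIndependent F fun i : Fin m => β ^ (i : ℕ)) {v w : ℕ → F}
    (hvw : ∑ i ∈ Finset.range m, algebraMap F K (v i) * β ^ i =
      ∑ i ∈ Finset.range m, algebraMap F K (w i) * β ^ i) {i : ℕ} (hi : i < m) : v i = w i := by
  rw [← Fin.sum_univ_eq_sum_range fun i => algebraMap F K (v i) * β ^ i,
    ← Fin.sum_univ_eq_sum_range fun i => algebraMap F K (w i) * β ^ i] at hvw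
  simp only [← Algebra.smul_def] at hvw
  rw [← sub_eq_zero, ← Finset.sum_sub_distrib] at hvw
  simp only [← sub_smul] at hvw
  exact sub_eq_zero.1 (Fintype.linearIndependent_iff.1 h (fun i => v i - w i) hvw ⟨i, hi⟩)

theorem LinearIndependent.exists_eq_sum_range [NeZero m] (hK : Module.finrank F K = m)
    (h : LinearIndependent F fun i : Fin m => β ^ (i : ℕ)) (x : K) :
    ∃ v : ℕ → F, x = ∑ i ∈ Finset.range m, algebraMap F K (v i) * β ^ i := by
  let B := basisOfLinearIndependentOfCardEqFinrank h (by simp [hK])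
  refine ⟨fun i => if hi : i < m then B.repr x ⟨i, hi⟩ else 0, ?_⟩
  rw [← Fin.sum_univ_eq_sum_range fun i =>
    algebraMap F K (if hi : i < m then B.repr x ⟨i, hi⟩ else 0) * β ^ i]
  conv_lhs => rw [← B.sum_repr x]
  refine Finset.sum_congr rfl fun i _ => ?_
  rw [dif_pos i.2, Algebra.smul_def]
  simp [B]

theorem pow_apply_sum_range {ζ : F} {σ₀ : K ≃ₐ[F] K} (hσβ : σ₀ β = algebraMap F K ζ * β)
    (s : ℕ) (n : F) (v : ℕ → F) :
    algebraMap F K n * (σ₀ ^ s) (∑ i ∈ Finset.range m, algebraMap F K (v i) * β ^ i) =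
      ∑ i ∈ Finset.range m, algebraMap F K (n * ζ ^ (s * i) * v i) * β ^ i := by
  have hs : (σ₀ ^ s) β = algebraMap F K (ζ ^ s) * β := by
    induction s with
    | zero => simp
    | succ s ih =>
      rw [pow_succ, AlgEquiv.mul_apply, hσβ, map_mul, ih, AlgEquiv.commutes, pow_succ ζ, map_mul]
      ring
  rw [map_sum, Finset.mul_sum]
  refine Finset.sum_congr rfl fun i _ => ?_
  rw [map_mul, map_pow, hs, AlgEquiv.commutes, mul_pow]
  simp only [map_mul, map_pow, pow_mul]
  ring

theorem notMem_range_of_mem_paramSet (h : LinearIndependent F fun i : Fin m => β ^ (i : ℕ))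
    {T : (I : Finset ℕ) → Set (TailTuple F I)} {a : K} (ha : a ∈ paramSet m β T) :
    a ∉ Set.range (algebraMap F K) := by
  rintro ⟨y, rfl⟩
  obtain ⟨I, ⟨hIm, hI0, hI1⟩, t, -, ht⟩ := mem_paramSet_iff.1 ha
  have hm : 0 < m := by
    obtain ⟨i, hi⟩ := Finset.nonempty_iff_ne_empty.2 hI0
    exact Nat.zero_lt_of_lt (Finset.mem_range.1 (hIm hi))
  have hy : algebraMap F K y =
      ∑ i ∈ Finset.range m, algebraMap F K (if i = 0 then y else 0) * β ^ i := by
    rw [Finset.sum_eq_single 0]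
    · simp
    · intro i _ hi
      simp [hi]
    · simp [hm.ne']
  rw [hy] at ht
  refine hI1 (Finset.eq_singleton_iff_nonempty_unique_mem.2
    ⟨Finset.nonempty_iff_ne_empty.2 hI0, fun i hi => ?_⟩)
  by_contra hi0
  have := h.eq_of_sum_range_eq ht (Finset.mem_range.1 (hIm hi))
  rw [if_neg hi0] at this
  exact (repCoeff_ne_zero_iff hI0 t i).2 hi this.symm

/-- Every element outside `F` is, up to a factor from `F` and conjugation, in the parametrizing
set: make the lowest nonzero coefficient `1`, and conjugate the others into `T`. -/
theorem exists_mem_paramSet [NeZero m] (hK : Module.finrank F K = m) {ζ : F}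
    (hζ0 : ζ ≠ 0) {σ₀ : K ≃ₐ[F] K} (hσβ : σ₀ β = algebraMap F K ζ * β)
    (h : LinearIndependent F fun i : Fin m => β ^ (i : ℕ))
    {T : (I : Finset ℕ) → Set (TailTuple F I)} (hT : ∀ I ∈ indexSets m, IsCosetReps m ζ I (T I))
    {c : K} (hc : c ∉ Set.range (algebraMap F K)) :
    ∃ a ∈ paramSet m β T, ∃ (s : ℕ) (n : F), n ≠ 0 ∧ c = algebraMap F K n * (σ₀ ^ s) a := by
  obtain ⟨v, rfl⟩ := h.exists_eq_sum_range hK c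
  classical
  let I := (Finset.range m).filter fun i => v i ≠ 0
  have hIv : ∀ i ∈ I, v i ≠ 0 := fun i hi => (Finset.mem_filter.1 hi).2
  have hvI : ∀ i < m, i ∉ I → v i = 0 := fun i hi hiI => by
    by_contra h0
    exact hiI (Finset.mem_filter.2 ⟨Finset.mem_range.2 hi, h0⟩)
  have hI : I ∈ indexSets m := by
    have key : ¬ I ⊆ {0} := fun hsub => hc ⟨v 0, by
      rw [Finset.sum_eq_single 0]
      · simp
      · intro i hi hi0
        rw [hvI i (Finset.mem_range.1 hi) fun hiI => hi0 (Finset.mem_singleton.1 (hsub hiI)),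
          map_zero, zero_mul]
      · simp [NeZero.ne m]⟩
    exact ⟨Finset.filter_subset _ _, fun h0 => key (by simp [h0]), fun h0 => key (by simp [h0])⟩
  have hlead := leadIdx_mem hI.2.1
  set i₀ := leadIdx I with hi₀
  let w : TailTuple F I := fun i =>
    Units.mk0 (v i / v i₀) (div_ne_zero (hIv _ (Finset.mem_of_mem_erase i.2)) (hIv _ hlead))
  obtain ⟨t, ⟨htT, d, ⟨s, -, hd⟩, hw⟩, -⟩ := hT I hI w
  refine ⟨_, mem_paramSet_iff.2 ⟨I, hI, t, htT, rfl⟩, s, v i₀ / ζ ^ (s * i₀),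
    div_ne_zero (hIv _ hlead) (pow_ne_zero _ hζ0), ?_⟩
  rw [pow_apply_sum_range hσβ]
  refine Finset.sum_congr rfl fun i hi => ?_
  congr 2
  by_cases hiI : i ∈ I
  · by_cases hii : i = i₀
    · rw [hii, hi₀, repCoeff_leadIdx, mul_one, div_mul_cancel₀ _ (pow_ne_zero _ hζ0)]
    · have hmem : i ∈ I.erase (leadIdx I) := Finset.mem_erase.2 ⟨hii, hiI⟩
      rw [show repCoeff t i = t ⟨i, hmem⟩ from repCoeff_of_mem t ⟨i, hmem⟩]
      have h1 := congrArg Units.val (congrFun hw ⟨i, hmem⟩)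
      rw [Pi.mul_apply, Units.val_mul, hd ⟨i, hmem⟩] at h1
      simp only [w, Units.val_mk0] at h1
      rw [div_eq_iff (hIv _ hlead)] at h1
      have h2 : s * i = s * (i - i₀) + s * i₀ := by
        rw [← mul_add, Nat.sub_add_cancel (leadIdx_le hiI)]
      rw [h1, h2, pow_add, div_mul_eq_mul_div, div_mul_eq_mul_div, eq_div_iff (pow_ne_zero _ hζ0)]
      ring
  · rw [hvI i (Finset.mem_range.1 hi) hiI,
      not_not.1 (mt (repCoeff_ne_zero_iff hI.2.1 t i).1 hiI), mul_zero]

theorem IsPrimitiveRoot.exists_mem_Icc_pow_eq {ζ : F} (hζ : IsPrimitiveRoot ζ m) (hm : 0 < m)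
    (s : ℕ) : ∃ s' ∈ Finset.Icc 1 m, ζ ^ s' = ζ ^ s := by
  refine ⟨(s + (m - 1)) % m + 1, ?_, ?_⟩
  · have := Nat.mod_lt (s + (m - 1)) hm
    rw [Finset.mem_Icc]
    omega
  · rw [pow_succ, ← pow_eq_pow_mod _ hζ.pow_eq_one, ← pow_succ,
      show s + (m - 1) + 1 = s + m by omega, pow_add, hζ.pow_eq_one, mul_one]

/-- Elements of the parametrizing set that are conjugate up to a factor from `F` are equal. -/
theorem eq_of_mem_paramSet {ζ : F} (hζ : IsPrimitiveRoot ζ m)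
    {σ₀ : K ≃ₐ[F] K} (hσβ : σ₀ β = algebraMap F K ζ * β)
    (h : LinearIndependent F fun i : Fin m => β ^ (i : ℕ))
    {T : (I : Finset ℕ) → Set (TailTuple F I)} (hT : ∀ I ∈ indexSets m, IsCosetReps m ζ I (T I))
    {a a' : K} (ha : a ∈ paramSet m β T) (ha' : a' ∈ paramSet m β T) {s : ℕ} {n : F}
    (haa' : a' = algebraMap F K n * (σ₀ ^ s) a) : a = a' := by
  obtain ⟨I, hI, t, ht, rfl⟩ := mem_paramSet_iff.1 ha
  obtain ⟨I', hI', t', ht', rfl⟩ := mem_paramSet_iff.1 ha'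
  rw [pow_apply_sum_range hσβ] at haa'
  have hco : ∀ i < m, repCoeff t' i = n * ζ ^ (s * i) * repCoeff t i := fun i hi =>
    h.eq_of_sum_range_eq haa' hi
  have hlead : ∀ {J : Finset ℕ}, J ∈ indexSets m → leadIdx J < m := fun hJ =>
    Finset.mem_range.1 (hJ.1 (leadIdx_mem hJ.2.1))
  have hm := Nat.zero_lt_of_lt (hlead hI)
  have hζ0 : ζ ≠ 0 := hζ.ne_zero hm.ne'
  have hn : n ≠ 0 := by
    rintro rfl
    have := hco _ (hlead hI')
    rw [repCoeff_leadIdx, zero_mul, zero_mul] at this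
    exact one_ne_zero this
  have hII' : I = I' := by
    have key : ∀ i < m, (i ∈ I ↔ i ∈ I') := fun i hi => by
      rw [← repCoeff_ne_zero_iff hI.2.1 t, ← repCoeff_ne_zero_iff hI'.2.1 t', hco i hi]
      simp [hn, hζ0]
    ext i
    exact ⟨fun hi => (key i (Finset.mem_range.1 (hI.1 hi))).1 hi,
      fun hi => (key i (Finset.mem_range.1 (hI'.1 hi))).2 hi⟩
  subst hII'
  have hn1 : n * ζ ^ (s * leadIdx I) = 1 := by
    have := hco _ (hlead hI)
    rw [repCoeff_leadIdx, repCoeff_leadIdx, mul_one] at this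
    exact this.symm
  obtain ⟨s', hs', hss'⟩ := hζ.exists_mem_Icc_pow_eq hm s
  -- `t'` lies in the coset of `t` and, trivially, in its own
  have htt' : t' = t := by
    refine (hT I hI t').unique ⟨ht', 1, ⟨m, Finset.mem_Icc.2 ⟨hm, le_rfl⟩, fun i => ?_⟩,
      (one_mul _).symm⟩ ⟨ht, fun i => Units.mk0 (ζ ^ (s * ((i : ℕ) - leadIdx I)))
        (pow_ne_zero _ hζ0), ⟨s', hs', fun i => ?_⟩, ?_⟩
    · rw [pow_mul, hζ.pow_eq_one, one_pow]
      rfl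
    · rw [Units.val_mk0, pow_mul, pow_mul, hss']
    · ext i
      have hiI := Finset.mem_of_mem_erase i.2
      rw [Pi.mul_apply, Units.val_mul, Units.val_mk0, ← repCoeff_of_mem t', ← repCoeff_of_mem t,
        hco _ (Finset.mem_range.1 (hI.1 hiI))]
      have h2 : s * (i : ℕ) = s * leadIdx I + s * ((i : ℕ) - leadIdx I) := by
        rw [← mul_add, Nat.add_sub_cancel' (leadIdx_le hiI)]
      rw [h2, pow_add, ← mul_assoc n, hn1, one_mul]
  rw [htt']

end Parameters

/-! ### Classification over a finite field -/

/-- Extensions of a finite field `F` of the same degree are isomorphic: both are splitting fields of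
`X^q - X`, where `q` is the number of their elements. -/
theorem FiniteField.nonempty_algEquiv_of_finrank_eq (F : Type*) {K L : Type*} [Field F] [Finite F]
    [Field K] [Algebra F K] [FiniteDimensional F K] [Field L] [Algebra F L] [FiniteDimensional F L]
    (h : Module.finrank F L = Module.finrank F K) : Nonempty (L ≃ₐ[F] K) := by
  have := Module.finite_of_finite F (M := K)
  have := Module.finite_of_finite F (M := L)
  have := Fintype.ofFinite K
  have := Fintype.ofFinite L
  have := Fintype.ofFinite F
  have hcard : Fintype.card L = Fintype.card K := by
    rw [Module.card_eq_pow_finrank (K := F) (V := K), Module.card_eq_pow_finrank (K := F) (V := L), h]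
  have h1 := FiniteField.isSplittingField_sub K F
  have h2 := FiniteField.isSplittingField_sub L F
  rw [hcard] at h2
  let P : Polynomial F := Polynomial.X ^ Fintype.card K - Polynomial.X
  exact ⟨(Polynomial.IsSplittingField.algEquiv L P).trans
    (Polynomial.IsSplittingField.algEquiv K P).symm⟩

/-- Every proper nonassociative cyclic algebra over a finite field is isomorphic to one whose
parameter lies in the parametrizing set, since the norm is surjective. -/
theorem CyclicAlg.exists_mem_paramSet_algIsomorphic {F K L : Type*} [Field F] [Field K]
    [Algebra F K] [Finite K] [Field L] [Algebra F L] {m : ℕ} [NeZero m]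
    (hK : Module.finrank F K = m) {ζ : F} (hζ0 : ζ ≠ 0) {σ₀ : K ≃ₐ[F] K} {β : K}
    (hσβ : σ₀ β = algebraMap F K ζ * β) (hli : LinearIndependent F fun i : Fin m => β ^ (i : ℕ))
    {T : (I : Finset ℕ) → Set (TailTuple F I)} (hT : ∀ I ∈ indexSets m, IsCosetReps m ζ I (T I))
    {τ : L ≃ₐ[F] L} {σ : K ≃ₐ[F] K} (hσ : IsGalGenerator σ) (e : L ≃ₐ[F] K)
    (he : ∀ x, e (τ x) = σ (e x)) {c : L} (hc : c ∉ Set.range (algebraMap F L)) :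
    ∃ a ∈ paramSet m β T, AlgIsomorphic F (CyclicAlg m τ c) (CyclicAlg m σ a) := by
  have hec : e c ∉ Set.range (algebraMap F K) := by
    rintro ⟨y, hy⟩
    exact hc ⟨y, e.injective (by rw [AlgEquiv.commutes, hy])⟩
  obtain ⟨a, ha, s, n, hn, han⟩ := exists_mem_paramSet hK hζ0 hσβ hli hT hec
  obtain ⟨p, hp⟩ := FiniteField.norm_surjective F K n
  have hcancel : ∀ x, (σ₀ ^ s)⁻¹ ((σ₀ ^ s) x) = x := fun x => (σ₀ ^ s).symm_apply_apply x
  refine ⟨a, ha, CyclicAlg.algIsomorphic_of_apply_eq hK hσ (e.trans (σ₀ ^ s)⁻¹) (fun x => ?_)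
    (p := p) ?_ ?_⟩
  · rw [AlgEquiv.trans_apply, AlgEquiv.trans_apply, he, ← AlgEquiv.mul_apply,
      ← AlgEquiv.mul_apply, hσ.mul_comm]
  · rintro rfl
    rw [Algebra.norm_zero] at hp
    exact hn hp.symm
  · rw [AlgEquiv.trans_apply, han, hp, map_mul, AlgEquiv.commutes, hcancel]

theorem mainTheorem4 {F : Type*} {K : Type*} [Field F] [Finite F] [Field K] [Algebra F K]
    (m : ℕ) (hm : m.Prime) (hm2 : m ≠ 2) (hchar : ringChar F ≠ 2)
    (hK : Module.finrank F K = m)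
    (ζ : F) (hζ : IsPrimitiveRoot ζ m)
    (σ₀ : K ≃ₐ[F] K) (hσ₀ : IsGalGenerator σ₀)
    (b : F) (hb : ∀ c : F, c ^ m ≠ b)
    (β : K) (hβ : β ^ m = algebraMap F K b) (hσβ : σ₀ β = algebraMap F K ζ * β)
    (T : (I : Finset ℕ) → Set (TailTuple F I))
    (hT : ∀ I ∈ indexSets m, IsCosetReps m ζ I (T I)) :
    -- the listed algebras are proper nonassociative cyclic algebras
    (∀ σ : K ≃ₐ[F] K, IsGalGenerator σ → ∀ a ∈ paramSet m β T,
      a ∉ Set.range (algebraMap F K) ∧ ¬ ∀ x y z : CyclicAlg m σ a, x * y * z = x * (y * z)) ∧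
    -- every proper nonassociative cyclic algebra of degree `m` over `F` is isomorphic to one
    (∀ (L : Type*) [Field L] [Algebra F L], IsGalois F L → Module.finrank F L = m →
      Nonempty (L ≃ₐ[F] K) ∧
      ∀ τ : L ≃ₐ[F] L, IsGalGenerator τ → ∀ c : L, c ∉ Set.range (algebraMap F L) →
        ∃ σ : K ≃ₐ[F] K, IsGalGenerator σ ∧ ∃ a ∈ paramSet m β T,
          AlgIsomorphic F (CyclicAlg m τ c) (CyclicAlg m σ a)) ∧
    -- distinct parameters give nonisomorphic algebras
    (∀ σ σ' : K ≃ₐ[F] K, IsGalGenerator σ → IsGalGenerator σ' →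
      ∀ a ∈ paramSet m β T, ∀ a' ∈ paramSet m β T,
        AlgIsomorphic F (CyclicAlg m σ a) (CyclicAlg m σ' a') → σ = σ' ∧ a = a') ∧
    -- for each fixed generator, the same set represents the isotopy classes
    (∀ σ : K ≃ₐ[F] K, IsGalGenerator σ → ∀ c : K, c ∉ Set.range (algebraMap F K) →
      ∃! a : K, a ∈ paramSet m β T ∧
        AlgIsotopic F (CyclicAlg m σ c) (CyclicAlg m σ a)) := by
  have hm2' := hm.two_le
  have hm0 : NeZero m := ⟨by omega⟩
  have : FiniteDimensional F K := FiniteDimensional.of_finrank_pos (by omega)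
  have : Finite K := Module.finite_of_finite F
  have hβ0 : β ≠ 0 := by
    rintro rfl
    rw [zero_pow hm.ne_zero, eq_comm, map_eq_zero] at hβ
    exact hb 0 (by rw [hβ, zero_pow hm.ne_zero])
  have hli := linearIndependent_pow_of_apply_eq_mul hζ hβ0 hσβ
  have hζ0 : ζ ≠ 0 := hζ.ne_zero hm.ne_zero
  have hpow : ∀ ρ : K ≃ₐ[F] K, ∃ s : ℕ, σ₀ ^ s = ρ := fun ρ =>
    mem_powers_iff_mem_zpowers.2 (hσ₀ ρ)
  have hunique : ∀ (ρ : K ≃ₐ[F] K) (n : F), n ≠ 0 → ∀ a ∈ paramSet m β T, ∀ a' ∈ paramSet m β T,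
      ρ a = algebraMap F K n * a' → a = a' := by
    intro ρ n hn a ha a' ha' h
    obtain ⟨s, rfl⟩ := hpow ρ
    refine eq_of_mem_paramSet hζ hσβ hli hT ha ha' (s := s) (n := n⁻¹) ?_
    rw [h, ← mul_assoc, ← map_mul, inv_mul_cancel₀ hn, map_one, one_mul]
  refine ⟨fun σ hσ a ha => ?_, fun L _ _ _ hL => ?_, fun σ σ' hσ hσ' a ha a' ha' h => ?_,
    fun σ hσ c hc => ?_⟩
  · have haF := notMem_range_of_mem_paramSet hli ha
    refine ⟨haF, ?_⟩
    subst hK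
    exact CyclicAlg.not_assoc hm2' hσ.pow_finrank fun r hr =>
      hσ.pow_apply_ne hm haF r fun h0 => hr (Fin.ext (by simpa using h0))
  · have : FiniteDimensional F L := FiniteDimensional.of_finrank_pos (by omega)
    obtain ⟨e⟩ := FiniteField.nonempty_algEquiv_of_finrank_eq F (hL.trans hK.symm)
    refine ⟨⟨e⟩, fun τ hτ c hc => ?_⟩
    have hσ : IsGalGenerator (AlgEquiv.autCongr e τ) := fun ρ => by
      obtain ⟨k, hk⟩ := hτ ((AlgEquiv.autCongr e).symm ρ)
      refine ⟨k, ?_⟩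
      simp only at hk ⊢
      rw [← map_zpow, hk, MulEquiv.apply_symm_apply]
    obtain ⟨a, ha, hiso⟩ := CyclicAlg.exists_mem_paramSet_algIsomorphic hK hζ0 hσβ hli hT hσ e
      (τ := τ) (fun x => by simp) hc
    exact ⟨_, hσ, a, ha, hiso⟩
  · have haF' := notMem_range_of_mem_paramSet hli ha'
    obtain rfl := CyclicAlg.eq_of_algIsomorphic hK hm hσ hσ' haF' h
    obtain ⟨ρ, n, hn, hρ⟩ := CyclicAlg.exists_algEquiv_apply_eq_of_algIsotopic hK hm hm2 hσ haF'
      h.algIsotopic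
    exact ⟨rfl, hunique ρ n hn a ha a' ha' hρ⟩
  · obtain ⟨a, ha, hiso⟩ := CyclicAlg.exists_mem_paramSet_algIsomorphic hK hζ0 hσβ hli hT hσ
      AlgEquiv.refl (τ := σ) (fun x => rfl) hc
    refine ⟨a, ⟨ha, hiso.algIsotopic⟩, fun a' ⟨ha', hiso'⟩ => ?_⟩
    obtain ⟨ρ, n, hn, hρ⟩ := CyclicAlg.exists_algEquiv_apply_eq_of_algIsotopic hK hm hm2 hσ
      (notMem_range_of_mem_paramSet hli ha) hiso.algIsotopic
    obtain ⟨ρ', n', hn', hρ'⟩ := CyclicAlg.exists_algEquiv_apply_eq_of_algIsotopic hK hm hm2 hσ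
      (notMem_range_of_mem_paramSet hli ha') hiso'
    refine (hunique (ρ' * ρ⁻¹) (n' / n) (div_ne_zero hn' hn) a ha a' ha' ?_).symm
    have h1 : ρ⁻¹ (algebraMap F K n * a) = c := by
      rw [← hρ]
      exact ρ.symm_apply_apply c
    have h2 : ρ⁻¹ a = algebraMap F K n⁻¹ * c := by
      rw [← h1, map_mul, AlgEquiv.commutes, ← mul_assoc, ← map_mul, inv_mul_cancel₀ hn, map_one,
        one_mul]
    rw [AlgEquiv.mul_apply, h2, map_mul, AlgEquiv.commutes, hρ', ← mul_assoc, ← map_mul,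
      inv_mul_eq_div]
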